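/- **Setting.** Let $n,d\ge 1$ and let $\mathbb{S}^{d-1}$ be the Euclidean unit sphere of $\mathbb{R}^d$. A *$k$-message shuffle protocol* for $n$ users consists of a measurable message space $\mathcal{Z}$, a local randomizer $\mathcal{R}$ which assigns to every $v\in\mathbb{S}^{d-1}$ a random element $\mathcal{R}(v)$ of $\mathcal{Z}^k$, and a measurable aggregation $\mathcal{A}:\mathcal{Z}^{nk}\to\mathbb{R}^d$. On inputs $v_1,\dots,v_n\in\mathbb{S}^{d-1}$ the users run $\mathcal{R}$ independently, and the shuffler $\Pi$ applies an independent uniformly random permutation to all $nk$ messages. The protocol is *$(\varepsilon,\delta)$-shuffle DP* if $$\Pr[\Pi(\mathcal{R}(v_1),\dots,\mathcal{R}(v_n))\in U]\le e^{\varepsilon}\Pr[\Pi(\mathcal{R}(v_1'),\dots,\mathcal{R}(v_n'))\in U]+\delta$$ for all measurable $U\subseteq\mathcal{Z}^{nk}$ and all inputs $(v_i)$, $(v_i')$ that differ in at most one user's vector. Its mean squared error for vector aggregation is $$\mathsf{Err}(\mathcal{A},\mathcal{R})=\sup_{v_1,\dots,v_n\in\mathbb{S}^{d-1}}\mathbb{E}\Big\|\mathcal{A}(\Pi(\mathcal{R}(v_1),\dots,\mathcal{R}(v_n)))-\sum_{i=1}^n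 v_i\Big\|_2^2 .$$ **Theorem.** For $\varepsilon=O(1)$ and $\delta\in(0,1)$ there is an $(\varepsilon,\delta)$-shuffle DP protocol for vector aggregation of unit vectors in $\mathbb{R}^d$ that uses $\tilde O(\min(d,n\varepsilon^2))$ messages per user (and $\tilde O(1)$ messages if $n\varepsilon^2<1$) and has mean squared error $\tilde O(d/\varepsilon^2)$. Precisely: there is a universal constant $c\in\mathbb{N}$ such that for every $\varepsilon_0>0$ there is a constant $C>0$, depending only on $\varepsilon_0$, with the following property. For all integers $n,d\ge 1$ and all reals $0<\varepsilon\le\varepsilon_0$, $0<\delta<1$ there are $k\in\mathbb{N}$ and a $k$-message shuffle protocol $(\mathcal{A},\mathcal{R})$ for $n$ users with inputs in $\mathbb{S}^{d-1}$ which is $(\varepsilon,\delta)$-shuffle DP and satisfies $$k\le C\Big(1+\log\frac{nd}{\delta}\Big)^{c}\max\{1,\min(d,n\varepsilon^2)\}\quad\text{and}\quad \mathsf{Err}(\mathcal{A},\mathcal{R})\le C\Big(1+\log\frac{nd}{\delta}\Big)^{c}\,\frac{d}{\varepsilon^2}.$$ -/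

import Mathlib

open MeasureTheory
open scoped ENNReal

/-- The unit sphere of `d`-dimensional Euclidean space. -/
abbrev UnitSphere (d : ℕ) : Type :=
  Metric.sphere (0 : EuclideanSpace ℝ (Fin d)) 1

/-- Two datasets of `n` records are neighboring if they differ in the record of at most one user. -/
def Neighboring {X : Type*} {n : ℕ} (D D' : Fin n → X) : Prop :=
  ∃ i : Fin n, ∀ j : Fin n, j ≠ i → D j = D' j

/-- A randomized algorithm, given by its output law on each dataset, is
`(ε, δ)`-differentially private. -/
def IsDP {X R : Type*} [MeasurableSpace R] {n : ℕ} (ε δ : ℝ)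
    (M : (Fin n → X) → Measure R) : Prop :=
  ∀ D D' : Fin n → X, Neighboring D D' → ∀ U : Set R, MeasurableSet U →
    M D U ≤ ENNReal.ofReal (Real.exp ε) * M D' U + ENNReal.ofReal δ

/-- The shuffler: the law of the messages after a uniformly random permutation of them, chosen
independently of the messages, where `μ` is the joint law of the messages before shuffling. -/
noncomputable def shuffle {ι Z : Type} [Fintype ι] [DecidableEq ι] [MeasurableSpace Z]
    (μ : Measure (ι → Z)) : Measure (ι → Z) :=
  (Fintype.card (Equiv.Perm ι) : ℝ≥0∞)⁻¹ •
    ∑ σ : Equiv.Perm ι, μ.map (fun m : ι → Z => m ∘ σ)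

theorem isProbabilityMeasure_shuffle {ι Z : Type} [Fintype ι] [DecidableEq ι] [MeasurableSpace Z]
    (μ : Measure (ι → Z)) [IsProbabilityMeasure μ] : IsProbabilityMeasure (shuffle μ) := by
  constructor
  have h : ∀ σ : Equiv.Perm ι, μ.map (fun m : ι → Z => m ∘ σ) Set.univ = 1 := fun σ => by
    rw [Measure.map_apply (by unfold Function.comp; fun_prop) MeasurableSet.univ]
    simp
  simp only [shuffle, Measure.smul_apply, Measure.finsetSum_apply, h, smul_eq_mul,
    Finset.sum_const, Finset.card_univ, nsmul_eq_mul, mul_one]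
  exact ENNReal.inv_mul_cancel (by exact_mod_cast Fintype.card_ne_zero) (ENNReal.natCast_ne_top _)

/-- A protocol in the shuffle model for `n` users with inputs in the unit sphere of `ℝ^d`, each of
whom sends `k` messages: a message space, a local randomizer, run independently by every user, and
an aggregation of all `n * k` (shuffled) messages. -/
structure ShuffleProtocol (n d k : ℕ) where
  /-- The message space. -/
  Msg : Type
  /-- The events of the message space. -/
  [measurableSpaceMsg : MeasurableSpace Msg]
  /-- The law of the `k` messages that a user with a given input sends. -/
  randomizer : UnitSphere d → Measure (Fin k → Msg)
  isProbabilityMeasure_randomizer : ∀ v, IsProbabilityMeasure (randomizer v)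
  /-- The aggregation of the shuffled messages. -/
  aggregate : (Fin n × Fin k → Msg) → EuclideanSpace ℝ (Fin d)
  measurable_aggregate : Measurable aggregate

namespace ShuffleProtocol

attribute [instance] measurableSpaceMsg isProbabilityMeasure_randomizer

variable {n d k : ℕ}

/-- The joint law of all messages before shuffling: the users randomize independently. -/
noncomputable def messages (P : ShuffleProtocol n d k) (v : Fin n → UnitSphere d) :
    Measure (Fin n × Fin k → P.Msg) :=
  (Measure.pi fun i => P.randomizer (v i)).map
    (fun (m : Fin n → Fin k → P.Msg) (p : Fin n × Fin k) => m p.1 p.2)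

/-- The law of the output of the shuffler on the inputs `v`. -/
noncomputable def shuffled (P : ShuffleProtocol n d k) (v : Fin n → UnitSphere d) :
    Measure (Fin n × Fin k → P.Msg) :=
  shuffle (P.messages v)

/-- The protocol is `(ε, δ)`-shuffle DP: the output of the shuffler is `(ε, δ)`-DP. -/
def IsShuffleDP (P : ShuffleProtocol n d k) (ε δ : ℝ) : Prop :=
  IsDP ε δ P.shuffled

/-- The mean squared error of the protocol for vector aggregation, in the worst case over the
inputs; its values are extended nonnegative reals. -/
noncomputable def err (P : ShuffleProtocol n d k) : ℝ≥0∞ :=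
  ⨆ v : Fin n → UnitSphere d,
    ∫⁻ m, ‖P.aggregate m - ∑ i, (v i : EuclideanSpace ℝ (Fin d))‖ₑ ^ 2 ∂(P.shuffled v)

theorem isProbabilityMeasure_shuffled (P : ShuffleProtocol n d k) (v : Fin n → UnitSphere d) :
    IsProbabilityMeasure (P.shuffled v) := by
  have : IsProbabilityMeasure (P.messages v) :=
    Measure.isProbabilityMeasure_map (Measurable.aemeasurable (by fun_prop))
  exact isProbabilityMeasure_shuffle _

end ShuffleProtocol

/-! Each message carries the number of its round, and the estimate is the sum of fixed values of the
messages. The error is therefore that of a sum of independent variables (`expect_sub_sq_le`), and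
privacy has to be shown only for permutation invariant tests.

Privacy comes from a blanket (`expect_le_of_blanket`). Suppose that in round `a` every other user
draws from a reference law `U a` with probability `γ a`, and that user `i` has density `1 + h a`
with respect to `U a`. Condition on the set `S a` of users drawing from `U a`, with user `i` put
into it by a change of measure. An invariant test cannot tell the members of `S a` apart, so the
likelihood ratio of user `i` may be replaced by its average over `S a`, separately in each round
(`expect_mul_prod_eq_userAverage`). What remains is a product of independent factors `1 + X a`,
where `X a` is centered with variance at most `V a / |S a|`. Exponential moments keep this product
in `[exp (-ε/2), exp (ε/2)]` outside a small set, as soon as `∑ V a / |S a|` is of order `ε²` up to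
logarithms. Both inputs are compared with the common reference, which costs `ε/2` each.

Three protocols cover all parameters, with `T = 1 + log (nd/δ)`. If `nε` is below about `T²√d`, the
answer zero is accurate enough. If `nε²` is at most about `T⁵d`, each user sends about `nε²` random
signed coordinates, nearly uniform and slightly biased towards the vector. Because `‖v‖₁ ≤ √d`, the
bias can be strong enough for an unbiased estimate while its variance under the uniform law stays
bounded. If `nε²` is larger, each user sends all signed binary digits of all coordinates, with
randomized response. A unit vector has at most `min (4^l) d` nonzero digits of weight `2⁻ˡ`, and
only rounds with a nonzero digit cost privacy. Noise proportional to this number makes every level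
cost the same, and the factor `4⁻ˡ` in the variance pays for it. -/

/-- A probability law on a finite type, given by its weights. -/
def IsLaw {B : Type*} [Fintype B] (q : B → ℝ) : Prop :=
  (∀ b, 0 ≤ q b) ∧ ∑ b, q b = 1

/-- The weights of a product law. -/
noncomputable def prodLaw {ι B : Type*} [Fintype ι] (q : ι → B → ℝ) (y : ι → B) : ℝ :=
  ∏ x, q x (y x)

/-- The expectation of `F` under the product of the laws `q x`. -/
noncomputable def expect {ι B : Type*} [Fintype ι] [DecidableEq ι] [Fintype B]
    (q : ι → B → ℝ) (F : (ι → B) → ℝ) : ℝ :=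
  ∑ y, prodLaw q y * F y

/-! ### Expectations, moments and mixtures under finite product laws. -/

section Expect

variable {ι B : Type*} [Fintype ι] [DecidableEq ι] [Fintype B]

theorem expect_prod (q : ι → B → ℝ) (h : ι → B → ℝ) :
    expect q (fun y => ∏ x, h x (y x)) = ∏ x, ∑ b, q x b * h x b := by
  simp only [expect, prodLaw, ← Finset.prod_mul_distrib]
  rw [Finset.prod_univ_sum]
  simp

theorem isLaw_prodLaw {q : ι → B → ℝ} (hq : ∀ x, IsLaw (q x)) : IsLaw (prodLaw q) := by
  refine ⟨fun y => Finset.prod_nonneg fun x _ => (hq x).1 _, ?_⟩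
  have := expect_prod q (fun _ _ => 1)
  simpa [expect, (hq _).2] using this

theorem expect_const {q : ι → B → ℝ} (hq : ∀ x, IsLaw (q x)) (r : ℝ) :
    expect q (fun _ => r) = r := by
  simp [expect, ← Finset.sum_mul, (isLaw_prodLaw hq).2]

theorem expect_mono {q : ι → B → ℝ} (hq : ∀ x, IsLaw (q x)) {F G : (ι → B) → ℝ}
    (h : ∀ y, F y ≤ G y) : expect q F ≤ expect q G :=
  Finset.sum_le_sum fun y _ => mul_le_mul_of_nonneg_left (h y) ((isLaw_prodLaw hq).1 y)

theorem expect_nonneg {q : ι → B → ℝ} (hq : ∀ x, IsLaw (q x)) {F : (ι → B) → ℝ}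
    (h : ∀ y, 0 ≤ F y) : 0 ≤ expect q F :=
  Finset.sum_nonneg fun y _ => mul_nonneg ((isLaw_prodLaw hq).1 y) (h y)

theorem expect_add (q : ι → B → ℝ) (F G : (ι → B) → ℝ) :
    expect q (fun y => F y + G y) = expect q F + expect q G := by
  simp [expect, mul_add, Finset.sum_add_distrib]

theorem expect_const_mul (q : ι → B → ℝ) (r : ℝ) (F : (ι → B) → ℝ) :
    expect q (fun y => r * F y) = r * expect q F := by
  simp only [expect, Finset.mul_sum]
  exact Finset.sum_congr rfl fun y _ => by ring

theorem expect_sum {κ : Type*} (s : Finset κ) (q : ι → B → ℝ) (F : κ → (ι → B) → ℝ) :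
    expect q (fun y => ∑ j ∈ s, F j y) = ∑ j ∈ s, expect q (F j) := by
  simp only [expect, Finset.mul_sum]
  exact Finset.sum_comm

theorem expect_eval {q : ι → B → ℝ} (hq : ∀ x, IsLaw (q x)) (x : ι) (f : B → ℝ) :
    expect q (fun y => f (y x)) = ∑ b, q x b * f b := by
  have := expect_prod q (fun x' b => if x' = x then f b else 1)
  simp only [Finset.prod_ite_eq', Finset.mem_univ, if_true] at this
  rw [this, Finset.prod_eq_single x]
  · simp
  · intro x' _ hx
    simp [hx, (hq x').2]
  · simp

theorem expect_eval_mul_eval {q : ι → B → ℝ} (hq : ∀ x, IsLaw (q x)) {x x' : ι} (hne : x ≠ x')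
    (f g : B → ℝ) :
    expect q (fun y => f (y x) * g (y x')) = (∑ b, q x b * f b) * ∑ b, q x' b * g b := by
  have := expect_prod q
    (fun z b => (if z = x then f b else 1) * (if z = x' then g b else 1))
  simp only [Finset.prod_mul_distrib, Finset.prod_ite_eq', Finset.mem_univ, if_true] at this
  rw [this, ← Finset.mul_prod_erase _ _ (Finset.mem_univ x),
    ← Finset.mul_prod_erase _ _ (Finset.mem_erase.2 ⟨hne.symm, Finset.mem_univ x'⟩),
    Finset.prod_eq_one]
  · simp [hne, hne.symm]
  · intro z hz
    simp only [Finset.mem_erase, Finset.mem_univ, and_true] at hz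
    simp [hz.1, hz.2, (hq z).2]

/-- The second moment of a sum of independent centered variables. -/
theorem expect_sum_sq {q : ι → B → ℝ} (hq : ∀ x, IsLaw (q x)) (s : ι → B → ℝ)
    (hs : ∀ x, ∑ b, q x b * s x b = 0) :
    expect q (fun y => (∑ x, s x (y x)) ^ 2) = ∑ x, ∑ b, q x b * s x b ^ 2 := by
  have h1 : (fun y : ι → B => (∑ x, s x (y x)) ^ 2)
      = fun y => ∑ x, ∑ x', s x (y x) * s x' (y x') := by
    funext y
    rw [sq, Finset.sum_mul_sum]
  rw [h1, expect_sum]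
  refine Finset.sum_congr rfl fun x _ => ?_
  rw [expect_sum, Finset.sum_eq_single x]
  · have := expect_eval hq x (fun b => s x b * s x b)
    rw [this]
    simp [sq]
  · intro x' _ hne
    rw [expect_eval_mul_eval hq hne.symm, hs x, zero_mul]
  · simp

theorem expect_sum_eval {q : ι → B → ℝ} (hq : ∀ x, IsLaw (q x)) (s : ι → B → ℝ) :
    expect q (fun y => ∑ x, s x (y x)) = ∑ x, ∑ b, q x b * s x b := by
  rw [expect_sum]
  exact Finset.sum_congr rfl fun x _ => expect_eval hq x (s x)

/-- The bias-variance bound for the mean squared error of a sum of independent variables. -/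
theorem expect_sub_sq_le {q : ι → B → ℝ} (hq : ∀ x, IsLaw (q x)) (s : ι → B → ℝ) (r : ι → ℝ)
    (θ : ℝ) :
    expect q (fun y => (∑ x, s x (y x) - θ) ^ 2)
      ≤ ∑ x, ∑ b, q x b * (s x b - r x) ^ 2 + (∑ x, ∑ b, q x b * s x b - θ) ^ 2 := by
  set M : ι → ℝ := fun x => ∑ b, q x b * s x b with hM
  have h0 : ∀ x, ∑ b, q x b * (s x b - M x) = 0 := fun x => by
    simp only [mul_sub, Finset.sum_sub_distrib, ← Finset.sum_mul, (hq x).2, one_mul, hM, sub_self]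
  have h1 : (fun y : ι → B => (∑ x, s x (y x) - θ) ^ 2)
      = fun y => (∑ x, (s x (y x) - M x)) ^ 2
        + ((2 * (∑ x, M x - θ)) * ∑ x, (s x (y x) - M x) + (∑ x, M x - θ) ^ 2) := by
    funext y
    simp only [Finset.sum_sub_distrib]
    ring
  rw [h1, expect_add, expect_add, expect_const_mul, expect_const hq,
    expect_sum_sq hq (fun x b => s x b - M x) h0,
    expect_sum_eval hq (fun x b => s x b - M x)]
  simp only [h0, Finset.sum_const_zero, mul_zero, zero_add]
  refine add_le_add (Finset.sum_le_sum fun x _ => ?_) le_rfl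
  -- The mean minimizes the second moment, so any center `r x` gives a valid upper bound on the
  -- variance.
  have h2 : ∑ b, q x b * (s x b - r x) ^ 2
      = ∑ b, q x b * (s x b - M x) ^ 2 + (M x - r x) ^ 2 := by
    have : ∀ b, q x b * (s x b - r x) ^ 2 = q x b * (s x b - M x) ^ 2
        + ((2 * (M x - r x)) * (q x b * (s x b - M x)) + q x b * (M x - r x) ^ 2) := fun b => by
      ring
    simp only [this, Finset.sum_add_distrib, ← Finset.mul_sum, h0, ← Finset.sum_mul, (hq x).2]
    ring
  rw [h2]
  nlinarith [sq_nonneg (M x - r x)]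

theorem Real.exp_le_one_add_add_sq {s : ℝ} (hs : s ≤ 1) : Real.exp s ≤ 1 + s + s ^ 2 := by
  rcases le_or_gt (-1) s with h | h
  · have := Real.abs_exp_sub_one_sub_id_le (abs_le.2 ⟨h, hs⟩)
    linarith [abs_le.1 this]
  · have : Real.exp s ≤ 1 := Real.exp_le_one_iff.2 (by linarith)
    nlinarith

/-- The moment generating function of a sum of bounded independent centered variables. -/
theorem expect_exp_sum_le {q : ι → B → ℝ} (hq : ∀ x, IsLaw (q x)) (s : ι → B → ℝ)
    (hs : ∀ x, ∑ b, q x b * s x b = 0) (hb : ∀ x b, s x b ≤ 1) :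
    expect q (fun y => Real.exp (∑ x, s x (y x)))
      ≤ Real.exp (∑ x, ∑ b, q x b * s x b ^ 2) := by
  have hL : (fun y : ι → B => Real.exp (∑ x, s x (y x))) = fun y => ∏ x, Real.exp (s x (y x)) :=
    funext fun y => Real.exp_sum _ _
  rw [hL, Real.exp_sum, expect_prod q (fun x b => Real.exp (s x b))]
  refine Finset.prod_le_prod
    (fun x _ => Finset.sum_nonneg fun b _ => mul_nonneg ((hq x).1 b) (Real.exp_pos _).le)
    fun x _ => ?_
  calc ∑ b, q x b * Real.exp (s x b) ≤ ∑ b, q x b * (1 + s x b + s x b ^ 2) :=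
        Finset.sum_le_sum fun b _ =>
          mul_le_mul_of_nonneg_left (Real.exp_le_one_add_add_sq (hb x b)) ((hq x).1 b)
    _ = 1 + ∑ b, q x b * s x b ^ 2 := by
        simp only [mul_add, mul_one, Finset.sum_add_distrib, (hq x).2, hs, add_zero]
    _ ≤ _ := by linarith [Real.add_one_le_exp (∑ b, q x b * s x b ^ 2)]

/-- The law of a Bernoulli variable. -/
def bernoulliLaw (γ : ℝ) (c : Bool) : ℝ := if c then γ else 1 - γ

theorem isLaw_bernoulliLaw {γ : ℝ} (h0 : 0 ≤ γ) (h1 : γ ≤ 1) : IsLaw (bernoulliLaw γ) := by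
  refine ⟨fun b => ?_, by simp [bernoulliLaw]⟩
  cases b <;> simp [bernoulliLaw, h0, h1]

/-- Sampling from a mixture means tossing a coin per coordinate and then drawing from the selected
component. Conditioning on the coins `c` exposes the users who draw from the blanket. -/
theorem expect_mixture (γ : ι → ℝ) (u r : ι → B → ℝ) (F : (ι → B) → ℝ) :
    expect (fun x b => γ x * u x b + (1 - γ x) * r x b) F
      = expect (fun x => bernoulliLaw (γ x))
          (fun c => expect (fun x b => if c x then u x b else r x b) F) := by
  simp only [expect, prodLaw, Finset.mul_sum]
  rw [Finset.sum_comm]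
  refine Finset.sum_congr rfl fun y _ => ?_
  simp only [← mul_assoc, ← Finset.prod_mul_distrib, ← Finset.sum_mul]
  congr 1
  have := (Finset.prod_univ_sum (fun _ : ι => (Finset.univ : Finset Bool))
    (fun x c => bernoulliLaw (γ x) c * if c then u x (y x) else r x (y x)))
  simp only [Fintype.piFinset_univ] at this
  rw [← this]
  simp [bernoulliLaw]

theorem expect_comp_perm {q : ι → B → ℝ} (e : Equiv.Perm ι) (he : ∀ x, q (e x) = q x)
    (F : (ι → B) → ℝ) : expect q (fun y => F (y ∘ e)) = expect q F := by
  simp only [expect]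
  refine Fintype.sum_equiv (e.symm.arrowCongr (Equiv.refl B)) _ _ fun y => ?_
  have : (e.symm.arrowCongr (Equiv.refl B)) y = y ∘ e := by
    funext x; simp [Equiv.arrowCongr]
  rw [this]
  congr 1
  simp only [prodLaw]
  rw [← Equiv.prod_comp e]
  exact Finset.prod_congr rfl fun x _ => by rw [he]; rfl

end Expect

/-- Grouping the symbols of all users by round makes the rounds the independent coordinates, each
with values in `σ → B`. -/
theorem expect_curry {σ κ B : Type*} [Fintype σ] [DecidableEq σ] [Fintype κ] [DecidableEq κ]
    [Fintype B] (q : σ × κ → B → ℝ) (F : (σ × κ → B) → ℝ) :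
    expect q F = expect (fun a => prodLaw (fun t => q (t, a)))
      (fun y : κ → σ → B => F (fun x => y x.2 x.1)) := by
  simp only [expect]
  refine Fintype.sum_equiv
    ((Equiv.curry σ κ B).trans (Equiv.piComm (fun _ _ => B))) _ _ fun y => ?_
  congr 1
  simp only [prodLaw]
  rw [Fintype.prod_prod_type_right]
  rfl

/-! ### Tails of products of independent likelihood ratios. -/

section Composition

variable {κ Ω : Type*} [Fintype κ] [DecidableEq κ] [Fintype Ω]

/-- Below the level `exp t` the first term suffices. Above it, `F = F ^ m * F ^ (-(m - 1))` and the
last factor is at most `exp (-(m - 1) * t)`. This turns a moment bound on a likelihood ratio `F`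
into an additive privacy loss. -/
theorem mul_le_exp_mul_add {φ F m : ℝ} (h0 : 0 ≤ φ) (h1 : φ ≤ 1) (hF : 0 ≤ F) (hm : 1 ≤ m)
    (t : ℝ) : φ * F ≤ Real.exp t * φ + F ^ m * Real.exp (-(m - 1) * t) := by
  rcases le_or_gt F (Real.exp t) with h | h
  · have := mul_le_mul_of_nonneg_left h h0
    have : 0 ≤ F ^ m * Real.exp (-(m - 1) * t) := by positivity
    linarith
  · have hpos : 0 < F := (Real.exp_pos t).trans h
    have h2 : Real.exp ((m - 1) * t) ≤ F ^ (m - 1) := by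
      rw [mul_comm, Real.exp_mul]
      exact Real.rpow_le_rpow (Real.exp_pos _).le h.le (by linarith)
    have h3 : F ^ m = F ^ (m - 1) * F := by
      rw [← Real.rpow_add_one hpos.ne']; ring_nf
    have h4 : F ≤ F ^ m * Real.exp (-(m - 1) * t) := by
      rw [h3]
      have h5 : 1 ≤ F ^ (m - 1) * Real.exp (-(m - 1) * t) := by
        calc (1 : ℝ) = Real.exp ((m - 1) * t) * Real.exp (-(m - 1) * t) := by
              rw [← Real.exp_add]; ring_nf; simp
          _ ≤ _ := mul_le_mul_of_nonneg_right h2 (Real.exp_pos _).le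
      nlinarith
    have h6 : φ * F ≤ F := by nlinarith
    have : 0 ≤ Real.exp t * φ := by positivity
    linarith

/-- A product of independent likelihood ratios exceeds `exp t` only on a set of small probability. -/
theorem expect_mul_prod_one_add_le {P : κ → Ω → ℝ} (hP : ∀ a, IsLaw (P a)) {X : κ → Ω → ℝ}
    (hX : ∀ a z, -1 ≤ X a z) {v : κ → ℝ} {ρ μ t : ℝ} (hv : ∑ a, v a ≤ ρ) (hμ : 1 ≤ μ)
    (hexp : ∀ a, ∑ z, P a z * Real.exp (μ * X a z) ≤ Real.exp (μ ^ 2 * v a))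
    {φ : (κ → Ω) → ℝ} (h0 : ∀ y, 0 ≤ φ y) (h1 : ∀ y, φ y ≤ 1) :
    expect P (fun y => φ y * ∏ a, (1 + X a (y a)))
      ≤ Real.exp t * expect P φ + Real.exp (μ ^ 2 * ρ - (μ - 1) * t) := by
  have hF : ∀ y : κ → Ω, 0 ≤ ∏ a, (1 + X a (y a)) := fun y =>
    Finset.prod_nonneg fun a _ => by linarith [hX a (y a)]
  have hFm : ∀ y : κ → Ω, (∏ a, (1 + X a (y a))) ^ μ ≤ ∏ a, Real.exp (μ * X a (y a)) := fun y => by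
    rw [← Real.finsetProd_rpow _ _ (fun a _ => by linarith [hX a (y a)])]
    refine Finset.prod_le_prod
      (fun a _ => Real.rpow_nonneg (by linarith [hX a (y a)]) _) fun a _ => ?_
    rw [mul_comm, Real.exp_mul]
    exact Real.rpow_le_rpow (by linarith [hX a (y a)])
      (by linarith [Real.add_one_le_exp (X a (y a))]) (by linarith)
  calc expect P (fun y => φ y * ∏ a, (1 + X a (y a)))
      ≤ expect P (fun y => Real.exp t * φ y
          + Real.exp (-(μ - 1) * t) * ∏ a, Real.exp (μ * X a (y a))) := by
        refine expect_mono hP fun y => ?_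
        have := mul_le_exp_mul_add (h0 y) (h1 y) (hF y) hμ t
        nlinarith [hFm y, Real.exp_pos (-(μ - 1) * t)]
    _ = Real.exp t * expect P φ
          + Real.exp (-(μ - 1) * t) * ∏ a, ∑ z, P a z * Real.exp (μ * X a z) := by
        rw [expect_add, expect_const_mul, expect_const_mul,
          expect_prod P (fun a z => Real.exp (μ * X a z))]
    _ ≤ Real.exp t * expect P φ + Real.exp (-(μ - 1) * t) * Real.exp (μ ^ 2 * ρ) := by
        gcongr
        calc ∏ a, ∑ z, P a z * Real.exp (μ * X a z) ≤ ∏ a, Real.exp (μ ^ 2 * v a) :=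
              Finset.prod_le_prod (fun a _ => Finset.sum_nonneg fun z _ =>
                mul_nonneg ((hP a).1 z) (Real.exp_pos _).le) fun a _ => hexp a
          _ = Real.exp (μ ^ 2 * ∑ a, v a) := by rw [← Real.exp_sum, Finset.mul_sum]
          _ ≤ _ := by gcongr
    _ = _ := by
        rw [← Real.exp_add]; ring_nf

/-- A second-order lower bound for `log (1 + x)`, from `(1 + x)⁻¹ ≤ 1 - x + 2 * x ^ 2`. It needs `x`
away from `-1`, which is why the lower tail is treated with a truncation. -/
theorem exp_neg_sub_le_one_add {x : ℝ} (hx : |x| ≤ 1 / 2) :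
    Real.exp (-(-x + 2 * x ^ 2)) ≤ 1 + x := by
  have h := abs_le.1 hx
  have hpos : 0 < 1 + x := by linarith
  have h1 : (1 + x)⁻¹ ≤ 1 + (-x + 2 * x ^ 2) := by
    rw [inv_le_iff_one_le_mul₀ hpos]
    nlinarith [sq_nonneg x]
  have h2 : (1 + x)⁻¹ ≤ Real.exp (-x + 2 * x ^ 2) := by
    linarith [Real.add_one_le_exp (-x + 2 * x ^ 2)]
  rw [Real.exp_neg]
  exact inv_le_of_inv_le₀ hpos h2

/-- The truncated exponential lies below `1 - μ * X + 8 * μ ^ 2 * X ^ 2` everywhere: inside the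
truncation the exponent is at most `1`, so `exp s ≤ 1 + s + s ^ 2` applies, and outside the
quadratic is nonnegative. Centering removes the linear term. -/
theorem sum_truncated_exp_le {p : Ω → ℝ} (hp : IsLaw p) {X : Ω → ℝ} {v μ : ℝ} (hμ : 1 ≤ μ)
    (hmean : ∑ z, p z * X z = 0) (hsq : ∑ z, p z * X z ^ 2 ≤ v) :
    ∑ z, p z * (if |X z| ≤ 1 / (2 * μ) then Real.exp (μ * (-X z + 2 * X z ^ 2)) else 0)
      ≤ Real.exp (8 * μ ^ 2 * v) := by
  have hpt : ∀ z, (if |X z| ≤ 1 / (2 * μ) then Real.exp (μ * (-X z + 2 * X z ^ 2)) else 0)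
      ≤ 1 - μ * X z + 8 * μ ^ 2 * X z ^ 2 := fun z => by
    generalize X z = x
    split_ifs with h
    · have h' : |μ * x| ≤ 1 / 2 := by
        rw [abs_mul, abs_of_pos (by linarith : 0 < μ)]
        calc μ * |x| ≤ μ * (1 / (2 * μ)) := by gcongr
          _ = 1 / 2 := by field_simp
      have hx : |x| ≤ 1 / 2 := by
        rw [abs_mul, abs_of_pos (by linarith : 0 < μ)] at h'
        nlinarith [abs_nonneg x]
      obtain ⟨h1, h2⟩ := abs_le.1 h'
      obtain ⟨h3, h4⟩ := abs_le.1 hx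
      set w := μ * x with hw
      have hws : μ * (-x + 2 * x ^ 2) = w * (2 * x - 1) := by rw [hw]; ring
      have hxw : μ * x ^ 2 ≤ w ^ 2 := by rw [hw]; nlinarith [sq_nonneg x, mul_nonneg (by linarith : (0:ℝ) ≤ μ) (sq_nonneg x)]
      have hle : w * (2 * x - 1) ≤ 1 := by nlinarith [mul_nonneg (by linarith : (0:ℝ) ≤ μ) (sq_nonneg x)]
      rw [hws]
      have hs2 : (w * (2 * x - 1)) ^ 2 ≤ 4 * w ^ 2 := by
        rw [mul_pow, mul_comm]
        have : (2 * x - 1) ^ 2 ≤ 4 := by nlinarith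
        nlinarith [sq_nonneg w]
      have := Real.exp_le_one_add_add_sq hle
      have e : w * (2 * x - 1) = - w + 2 * (μ * x ^ 2) := by rw [hw]; ring
      have e2 : μ ^ 2 * x ^ 2 = w ^ 2 := by rw [hw]; ring
      nlinarith [sq_nonneg w]
    · have : 1 < 2 * |μ * x| := by
        rw [abs_mul, abs_of_pos (by linarith : 0 < μ)]
        rw [not_le, div_lt_iff₀ (by linarith)] at h
        linarith
      have h2 : μ * x ≤ |μ * x| := le_abs_self _
      have h3 : μ ^ 2 * x ^ 2 = |μ * x| ^ 2 := by rw [sq_abs]; ring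
      nlinarith
  calc _ ≤ ∑ z, p z * (1 - μ * X z + 8 * μ ^ 2 * X z ^ 2) :=
        Finset.sum_le_sum fun z _ => mul_le_mul_of_nonneg_left (hpt z) (hp.1 z)
    _ = 1 + 8 * μ ^ 2 * ∑ z, p z * X z ^ 2 := by
        have : ∀ z, p z * (1 - μ * X z + 8 * μ ^ 2 * X z ^ 2)
            = p z - μ * (p z * X z) + 8 * μ ^ 2 * (p z * X z ^ 2) := fun z => by ring
        simp only [this, Finset.sum_add_distrib, Finset.sum_sub_distrib, ← Finset.mul_sum, hmean,
          hp.2]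
        ring
    _ ≤ 1 + 8 * μ ^ 2 * v := by gcongr
    _ ≤ _ := by linarith [Real.add_one_le_exp (8 * μ ^ 2 * v)]

/-- A product of independent likelihood ratios falls below `exp (-t)` only on a set of small
probability. -/
theorem expect_le_mul_prod_one_add {P : κ → Ω → ℝ} (hP : ∀ a, IsLaw (P a)) {X : κ → Ω → ℝ}
    (hX : ∀ a z, -1 ≤ X a z) {v : κ → ℝ} {ρ μ ν t : ℝ} (hv : ∑ a, v a ≤ ρ) (hv0 : ∀ a, 0 ≤ v a)
    (hμ : 1 ≤ μ) (hν : 0 ≤ ν)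
    (hmean : ∀ a, ∑ z, P a z * X a z = 0) (hsq : ∀ a, ∑ z, P a z * X a z ^ 2 ≤ v a)
    (hexp : ∀ a, ∑ z, P a z * Real.exp (ν * X a z) ≤ Real.exp (ν ^ 2 * v a))
    (hexp' : ∀ a, ∑ z, P a z * Real.exp (-ν * X a z) ≤ Real.exp (ν ^ 2 * v a))
    {φ : (κ → Ω) → ℝ} (h0 : ∀ y, 0 ≤ φ y) (h1 : ∀ y, φ y ≤ 1) :
    expect P φ ≤ Real.exp t * expect P (fun y => φ y * ∏ a, (1 + X a (y a)))
      + Real.exp (8 * μ ^ 2 * ρ - μ * t)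
      + 2 * Fintype.card κ * Real.exp (ν ^ 2 * ρ - ν / (2 * μ)) := by
  -- `G` controls the inverse ratio where all `X a` are small. `I` dominates the indicator that `X
  -- a` is large, by the exponential Markov inequality with parameter `ν`.
  set G : κ → Ω → ℝ := fun a z =>
    if |X a z| ≤ 1 / (2 * μ) then Real.exp (μ * (-X a z + 2 * X a z ^ 2)) else 0 with hG
  set I : κ → Ω → ℝ := fun a z =>
    Real.exp (-(ν / (2 * μ))) * (Real.exp (ν * X a z) + Real.exp (-ν * X a z)) with hI
  have hG0 : ∀ a z, 0 ≤ G a z := fun a z => by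
    simp only [hG]; split_ifs <;> positivity
  have hI0 : ∀ a z, 0 ≤ I a z := fun a z => by simp only [hI]; positivity
  have hI1 : ∀ a z, 1 / (2 * μ) < |X a z| → 1 ≤ I a z := fun a z h => by
    have h2 : ν / (2 * μ) ≤ |ν * X a z| := by
      rw [abs_mul, abs_of_nonneg hν, div_eq_mul_one_div]
      gcongr
    have h3 : Real.exp (|ν * X a z|) ≤ Real.exp (ν * X a z) + Real.exp (-ν * X a z) := by
      rcases abs_choice (ν * X a z) with e | e <;> rw [e]
      · linarith [Real.exp_pos (-ν * X a z)]
      · rw [neg_mul]; linarith [Real.exp_pos (ν * X a z)]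
    calc (1 : ℝ) = Real.exp (-(ν / (2 * μ))) * Real.exp (ν / (2 * μ)) := by
          rw [← Real.exp_add]; simp
      _ ≤ _ := by
          simp only [hI]
          gcongr
          exact (Real.exp_le_exp.2 h2).trans h3
  have hpt : ∀ y : κ → Ω, φ y ≤ Real.exp t * (φ y * ∏ a, (1 + X a (y a)))
      + Real.exp (-(μ * t)) * ∏ a, G a (y a) + ∑ a, I a (y a) := fun y => by
    have hF : 0 ≤ ∏ a, (1 + X a (y a)) :=
      Finset.prod_nonneg fun a _ => by linarith [hX a (y a)]
    have hF' : 0 ≤ Real.exp t * (φ y * ∏ a, (1 + X a (y a))) :=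
      mul_nonneg (Real.exp_pos t).le (mul_nonneg (h0 y) hF)
    have hGp : 0 ≤ Real.exp (-(μ * t)) * ∏ a, G a (y a) :=
      mul_nonneg (Real.exp_pos _).le (Finset.prod_nonneg fun a _ => hG0 a _)
    have hIp : 0 ≤ ∑ a, I a (y a) := Finset.sum_nonneg fun a _ => hI0 a _
    -- Here the ratio is at least `exp (-S)`. Either `S ≤ t` and the ratio term alone suffices, or
    -- the factor `exp (μ * (S - t))` exceeds one.
    by_cases hall : ∀ a, |X a (y a)| ≤ 1 / (2 * μ)
    · set S : ℝ := ∑ a, (-X a (y a) + 2 * X a (y a) ^ 2) with hS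
      have hFS : Real.exp (-S) ≤ ∏ a, (1 + X a (y a)) := by
        rw [hS, ← Finset.sum_neg_distrib, Real.exp_sum]
        refine Finset.prod_le_prod (fun a _ => (Real.exp_pos _).le) fun a _ =>
          exp_neg_sub_le_one_add ((hall a).trans ?_)
        gcongr
        linarith
      have hGS : ∏ a, G a (y a) = Real.exp (μ * S) := by
        rw [hS, Finset.mul_sum, Real.exp_sum]
        exact Finset.prod_congr rfl fun a _ => by simp only [hG]; rw [if_pos (hall a)]
      rcases le_or_gt S t with h | h
      · have : 1 ≤ Real.exp t * ∏ a, (1 + X a (y a)) := by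
          calc (1 : ℝ) ≤ Real.exp (t - S) := Real.one_le_exp (by linarith)
            _ = Real.exp t * Real.exp (-S) := by rw [← Real.exp_add]; ring_nf
            _ ≤ _ := by gcongr
        have := mul_le_mul_of_nonneg_left this (h0 y)
        nlinarith
      · have : 1 ≤ Real.exp (-(μ * t)) * ∏ a, G a (y a) := by
          rw [hGS, ← Real.exp_add]
          exact Real.one_le_exp (by nlinarith)
        linarith [h1 y]
    · push Not at hall
      obtain ⟨a, ha⟩ := hall
      have := Finset.single_le_sum (f := fun a => I a (y a)) (fun a _ => hI0 a _)
        (Finset.mem_univ a)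
      linarith [h1 y, hI1 a _ ha]
  refine (expect_mono hP hpt).trans ?_
  rw [expect_add, expect_add, expect_const_mul, expect_const_mul, expect_prod P G,
    expect_sum_eval hP I]
  have hb1 : Real.exp (-(μ * t)) * ∏ a, ∑ z, P a z * G a z
      ≤ Real.exp (8 * μ ^ 2 * ρ - μ * t) := by
    calc _ ≤ Real.exp (-(μ * t)) * ∏ a, Real.exp (8 * μ ^ 2 * v a) := by
          gcongr with a
          · intro a _
            exact Finset.sum_nonneg fun z _ => mul_nonneg ((hP a).1 z) (hG0 a z)
          · exact sum_truncated_exp_le (hP a) hμ (hmean a) (hsq a)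
      _ = Real.exp (8 * μ ^ 2 * ∑ a, v a - μ * t) := by
          rw [← Real.exp_sum, ← Finset.mul_sum, ← Real.exp_add]; ring_nf
      _ ≤ _ := by gcongr
  have hb2 : ∑ a, ∑ z, P a z * I a z
      ≤ 2 * Fintype.card κ * Real.exp (ν ^ 2 * ρ - ν / (2 * μ)) := by
    calc ∑ a, ∑ z, P a z * I a z
        ≤ ∑ _a : κ, 2 * Real.exp (ν ^ 2 * ρ - ν / (2 * μ)) := by
          refine Finset.sum_le_sum fun a _ => ?_
          have e : ∀ z, P a z * I a z = Real.exp (-(ν / (2 * μ))) * (P a z * Real.exp (ν * X a z))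
              + Real.exp (-(ν / (2 * μ))) * (P a z * Real.exp (-ν * X a z)) := fun z => by
            simp only [hI]; ring
          simp only [e, Finset.sum_add_distrib, ← Finset.mul_sum]
          have hva : v a ≤ ρ :=
            (Finset.single_le_sum (fun a _ => hv0 a) (Finset.mem_univ a)).trans hv
          have h3 : Real.exp (ν ^ 2 * v a) ≤ Real.exp (ν ^ 2 * ρ) := by gcongr
          have h4 : Real.exp (ν ^ 2 * ρ - ν / (2 * μ))
              = Real.exp (-(ν / (2 * μ))) * Real.exp (ν ^ 2 * ρ) := by
            rw [← Real.exp_add]; ring_nf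
          rw [h4]
          nlinarith [hexp a, hexp' a, Real.exp_pos (-(ν / (2 * μ)))]
      _ = _ := by simp; ring
  linarith

end Composition

/-! ### Averages over the users of the blanket. -/

section Average

variable {σ B : Type*}

/-- The average of `h` over the symbols of the users in `S`. -/
noncomputable def userAverage (S : Finset σ) (h : B → ℝ) (z : σ → B) : ℝ :=
  (S.card : ℝ)⁻¹ * ∑ t ∈ S, h (z t)

/-- The contribution of one user to the average of `h` over the users in `S`. -/
noncomputable def userTerm [DecidableEq σ] (S : Finset σ) (h : B → ℝ) (t : σ) (b : B) : ℝ :=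
  if t ∈ S then (S.card : ℝ)⁻¹ * h b else 0

theorem userAverage_eq_sum [Fintype σ] [DecidableEq σ] (S : Finset σ) (h : B → ℝ) (z : σ → B) :
    userAverage S h z = ∑ t, userTerm S h t (z t) := by
  simp [userAverage, userTerm, Finset.mul_sum]

theorem neg_one_le_userAverage {S : Finset σ} (hS : S.Nonempty) {h : B → ℝ}
    (hh : ∀ b, -1 ≤ h b) (z : σ → B) : -1 ≤ userAverage S h z := by
  have hc : (0 : ℝ) < S.card := by exact_mod_cast hS.card_pos
  rw [userAverage, inv_mul_eq_div, le_div_iff₀ hc]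
  calc -1 * (S.card : ℝ) = ∑ _t ∈ S, (-1 : ℝ) := by simp
    _ ≤ _ := Finset.sum_le_sum fun t _ => hh _

theorem sum_userTerm [DecidableEq σ] [Fintype B] {p : σ → B → ℝ} {U : B → ℝ}
    {S : Finset σ} (hpU : ∀ t ∈ S, p t = U) {h : B → ℝ} (hmean : ∑ b, U b * h b = 0) (t : σ) :
    ∑ b, p t b * userTerm S h t b = 0 := by
  by_cases ht : t ∈ S
  · simp only [userTerm, ht, if_true, hpU t ht]
    calc _ = (S.card : ℝ)⁻¹ * ∑ b, U b * h b := by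
          rw [Finset.mul_sum]
          exact Finset.sum_congr rfl fun b _ => by ring
      _ = 0 := by rw [hmean, mul_zero]
  · simp [userTerm, ht]

theorem sum_sum_userTerm_sq_le [Fintype σ] [DecidableEq σ] [Fintype B]
    {p : σ → B → ℝ} {U : B → ℝ} {S : Finset σ}
    (hpU : ∀ t ∈ S, p t = U) {h : B → ℝ} (hS : S.Nonempty) {V : ℝ}
    (hV : ∑ b, U b * h b ^ 2 ≤ V) :
    ∑ t, ∑ b, p t b * userTerm S h t b ^ 2 ≤ V / S.card := by
  have hc : (0 : ℝ) < S.card := by exact_mod_cast hS.card_pos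
  have h1 : ∀ t, ∑ b, p t b * userTerm S h t b ^ 2
      = if t ∈ S then ((S.card : ℝ)⁻¹) ^ 2 * ∑ b, U b * h b ^ 2 else 0 := fun t => by
    by_cases ht : t ∈ S
    · simp only [userTerm, ht, if_true, hpU t ht, Finset.mul_sum]
      exact Finset.sum_congr rfl fun b _ => by ring
    · simp [userTerm, ht]
  simp only [h1, Finset.sum_ite_mem, Finset.univ_inter, Finset.sum_const, nsmul_eq_mul]
  calc _ = (∑ b, U b * h b ^ 2) / S.card := by field_simp
    _ ≤ _ := by gcongr

theorem expect_userAverage [Fintype σ] [DecidableEq σ] [Fintype B]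
    {p : σ → B → ℝ} (hp : ∀ t, IsLaw (p t)) {U : B → ℝ} {S : Finset σ}
    (hpU : ∀ t ∈ S, p t = U) {h : B → ℝ} (hmean : ∑ b, U b * h b = 0) :
    expect p (userAverage S h) = 0 := by
  rw [funext (userAverage_eq_sum S h), expect_sum_eval hp]
  exact Finset.sum_eq_zero fun t _ => sum_userTerm hpU hmean t

theorem expect_userAverage_sq_le [Fintype σ] [DecidableEq σ] [Fintype B]
    {p : σ → B → ℝ} (hp : ∀ t, IsLaw (p t)) {U : B → ℝ}
    {S : Finset σ} (hpU : ∀ t ∈ S, p t = U) {h : B → ℝ} (hmean : ∑ b, U b * h b = 0)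
    (hS : S.Nonempty) {V : ℝ} (hV : ∑ b, U b * h b ^ 2 ≤ V) :
    expect p (fun z => userAverage S h z ^ 2) ≤ V / S.card := by
  simp only [userAverage_eq_sum S h]
  rw [expect_sum_sq hp _ (sum_userTerm hpU hmean)]
  exact sum_sum_userTerm_sq_le hpU hS hV

/-- The condition on `ν * h` makes each user's share of the exponent at most `1`, as the quadratic
bound on the exponential requires. It is one-sided, so it is imposed separately for `ν` and `-ν`. -/
theorem expect_exp_userAverage_le [Fintype σ] [DecidableEq σ] [Fintype B]
    {p : σ → B → ℝ} (hp : ∀ t, IsLaw (p t)) {U : B → ℝ}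
    {S : Finset σ} (hpU : ∀ t ∈ S, p t = U) {h : B → ℝ} (hmean : ∑ b, U b * h b = 0)
    (hS : S.Nonempty) {V : ℝ} (hV : ∑ b, U b * h b ^ 2 ≤ V) {ν : ℝ}
    (hb : ∀ b, ν * h b ≤ S.card) :
    expect p (fun z => Real.exp (ν * userAverage S h z)) ≤ Real.exp (ν ^ 2 * (V / S.card)) := by
  have hc : (0 : ℝ) < S.card := by exact_mod_cast hS.card_pos
  simp only [userAverage_eq_sum S h, Finset.mul_sum]
  refine (expect_exp_sum_le hp (fun t b => ν * userTerm S h t b)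
    (fun t => ?_) (fun t b => ?_)).trans ?_
  · simp only [mul_left_comm _ ν, ← Finset.mul_sum]
    rw [sum_userTerm hpU hmean t, mul_zero]
  · simp only [userTerm]
    split_ifs
    · rw [mul_left_comm, inv_mul_eq_div]
      exact (div_le_one hc).2 (hb b)
    · simp
  · simp only [mul_pow, mul_left_comm _ (ν ^ 2), ← Finset.mul_sum]
    gcongr
    exact sum_sum_userTerm_sq_le hpU hS hV

theorem userAverage_one_add {S : Finset σ} (hS : S.Nonempty) (h : B → ℝ) (z : σ → B) :
    userAverage S (fun b => 1 + h b) z = 1 + userAverage S h z := by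
  have : (S.card : ℝ) ≠ 0 := by exact_mod_cast hS.card_pos.ne'
  simp [userAverage, Finset.sum_add_distrib, mul_add, this]

end Average

/-! ### Symmetrization over the blanket users. -/

section Symmetrize

variable {σ κ B : Type*} [Fintype σ] [DecidableEq σ] [Fintype κ] [DecidableEq κ] [Fintype B]

/-- Under a permutation invariant test, the likelihood ratio of one user may be averaged over all
users with the same law. -/
theorem expect_mul_prod_eq_userAverage {q : σ × κ → B → ℝ} {S : κ → Finset σ} {i : σ}
    (hi : ∀ a, i ∈ S a) (hq : ∀ a, ∀ t ∈ S a, q (t, a) = q (i, a)) {φ : (σ × κ → B) → ℝ}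
    (hφ : ∀ (e : Equiv.Perm (σ × κ)) y, φ (y ∘ e) = φ y) (g : κ → B → ℝ) :
    expect q (fun y => φ y * ∏ a, g a (y (i, a)))
      = expect q (fun y => φ y * ∏ a, userAverage (S a) (g a) (fun t => y (t, a))) := by
  have h1 : (fun y : σ × κ → B => φ y * ∏ a, userAverage (S a) (g a) (fun t => y (t, a)))
      = fun y => (∏ a, ((S a).card : ℝ)⁻¹) *
        ∑ τ ∈ Fintype.piFinset S, φ y * ∏ a, g a (y (τ a, a)) := by
    funext y
    simp only [userAverage, Finset.prod_mul_distrib]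
    rw [Finset.prod_univ_sum, ← Finset.mul_sum]
    ring
  have h2 : ∀ τ ∈ Fintype.piFinset S, expect q (fun y => φ y * ∏ a, g a (y (τ a, a)))
      = expect q (fun y => φ y * ∏ a, g a (y (i, a))) := fun τ hτ => by
    rw [Fintype.mem_piFinset] at hτ
    -- Each round swaps its message of user `i` with that of user `τ a`. Both follow the same law,
    -- so the product law is preserved, and the test does not notice.
    have := expect_comp_perm (q := q) (Equiv.prodCongrLeft fun a => Equiv.swap i (τ a))
      (fun x => by
        obtain ⟨t, a⟩ := x
        simp only [Equiv.prodCongrLeft_apply]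
        rcases eq_or_ne t i with rfl | h
        · rw [Equiv.swap_apply_left, hq a _ (hτ a)]
        rcases eq_or_ne t (τ a) with rfl | h'
        · rw [Equiv.swap_apply_right, hq a _ (hτ a)]
        · rw [Equiv.swap_apply_of_ne_of_ne h h'])
      (fun y => φ y * ∏ a, g a (y (i, a)))
    rw [← this]
    simp [hφ]
  rw [h1, expect_const_mul, expect_sum, Finset.sum_congr rfl h2, Finset.sum_const,
    Fintype.card_piFinset, nsmul_eq_mul, ← mul_assoc, Nat.cast_prod, ← Finset.prod_mul_distrib,
    Finset.prod_eq_one, one_mul]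
  intro a _
  have : ((S a).card : ℝ) ≠ 0 := by exact_mod_cast (Finset.card_pos.2 ⟨i, hi a⟩).ne'
  exact inv_mul_cancel₀ this

/-- The privacy guarantee when the sets of users whose symbols follow the reference laws are
fixed. -/
theorem expect_mul_prod_le_of_blanket {q : σ × κ → B → ℝ} (hqlaw : ∀ x, IsLaw (q x))
    {S : κ → Finset σ} {i : σ}
    (hi : ∀ a, i ∈ S a) (hq : ∀ a, ∀ t ∈ S a, q (t, a) = q (i, a)) {φ : (σ × κ → B) → ℝ}
    (hφ : ∀ (e : Equiv.Perm (σ × κ)) y, φ (y ∘ e) = φ y) (h0 : ∀ y, 0 ≤ φ y) (h1 : ∀ y, φ y ≤ 1)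
    {h h' : κ → B → ℝ} {V H : κ → ℝ} {ρ μ ν t : ℝ}
    (hge : ∀ a b, -1 ≤ h a b) (hge' : ∀ a b, -1 ≤ h' a b)
    (hmean : ∀ a, ∑ b, q (i, a) b * h a b = 0) (hmean' : ∀ a, ∑ b, q (i, a) b * h' a b = 0)
    (hV : ∀ a, ∑ b, q (i, a) b * h a b ^ 2 ≤ V a) (hV' : ∀ a, ∑ b, q (i, a) b * h' a b ^ 2 ≤ V a)
    (hH : ∀ a b, |h a b| ≤ H a) (hH' : ∀ a b, |h' a b| ≤ H a)
    (hρ : ∑ a, V a / (S a).card ≤ ρ) (hν : ∀ a, ν * H a ≤ (S a).card) (hμ : 1 ≤ μ) (hμν : μ ≤ ν) :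
    expect q (fun y => φ y * ∏ a, (1 + h a (y (i, a))))
      ≤ Real.exp t * (Real.exp t * expect q (fun y => φ y * ∏ a, (1 + h' a (y (i, a))))
          + Real.exp (8 * μ ^ 2 * ρ - μ * t)
          + 2 * Fintype.card κ * Real.exp (ν ^ 2 * ρ - ν / (2 * μ)))
        + Real.exp (μ ^ 2 * ρ - (μ - 1) * t) := by
  have hne : ∀ a, (S a).Nonempty := fun a => ⟨i, hi a⟩
  have hν0 : 0 ≤ ν := by linarith
  have hbd : ∀ {w : ℝ}, |w| ≤ ν → ∀ {g : κ → B → ℝ}, (∀ a b, |g a b| ≤ H a) →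
      ∀ a b, w * g a b ≤ (S a).card := fun {w} hw {g} hg a b => by
    calc w * g a b ≤ |w * g a b| := le_abs_self _
      _ ≤ ν * H a := by rw [abs_mul]; exact mul_le_mul hw (hg a b) (abs_nonneg _) hν0
      _ ≤ _ := hν a
  have hP : ∀ a, IsLaw (prodLaw fun t => q (t, a)) := fun a => isLaw_prodLaw fun t => hqlaw _
  have key : ∀ g : κ → B → ℝ, expect q (fun y => φ y * ∏ a, (1 + g a (y (i, a))))
      = expect (fun a => prodLaw (fun t => q (t, a))) (fun y : κ → σ → B =>
        φ (fun x => y x.2 x.1) * ∏ a, (1 + userAverage (S a) (g a) (y a))) := fun g => by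
    rw [expect_mul_prod_eq_userAverage hi hq hφ (fun a b => 1 + g a b), expect_curry]
    simp only [userAverage_one_add (hne _)]
  have hφc : expect q φ = expect (fun a => prodLaw (fun t => q (t, a)))
      (fun y : κ → σ → B => φ (fun x => y x.2 x.1)) := expect_curry q φ
  have hV0 : ∀ a, 0 ≤ V a := fun a =>
    (Finset.sum_nonneg fun b _ => mul_nonneg ((hqlaw _).1 b) (sq_nonneg _)).trans (hV a)
  have up := expect_mul_prod_one_add_le hP (X := fun a => userAverage (S a) (h a))
    (fun a z => neg_one_le_userAverage (hne a) (hge a) z) (v := fun a => V a / (S a).card) hρ hμ (t := t)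
    (fun a => expect_exp_userAverage_le (fun t => hqlaw _) (hq a) (hmean a) (hne a) (hV a)
      (hbd (by rwa [abs_of_pos (by linarith)]) hH a))
    (φ := fun y : κ → σ → B => φ (fun x => y x.2 x.1)) (fun y => h0 _) (fun y => h1 _)
  have down := expect_le_mul_prod_one_add hP (X := fun a => userAverage (S a) (h' a))
    (fun a z => neg_one_le_userAverage (hne a) (hge' a) z) (v := fun a => V a / (S a).card) hρ
    (fun a => div_nonneg (hV0 a) (Nat.cast_nonneg _)) hμ hν0 (t := t)
    (fun a => expect_userAverage (fun t => hqlaw _) (hq a) (hmean' a))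
    (fun a => expect_userAverage_sq_le (fun t => hqlaw _) (hq a) (hmean' a) (hne a) (hV' a))
    (fun a => expect_exp_userAverage_le (fun t => hqlaw _) (hq a) (hmean' a) (hne a) (hV' a)
      (hbd (by rw [abs_of_nonneg hν0]) hH' a))
    (fun a => by
      have := expect_exp_userAverage_le (fun t => hqlaw _) (hq a) (hmean' a) (hne a) (hV' a) (ν := -ν)
        (hbd (by rw [abs_neg, abs_of_nonneg hν0]) hH' a)
      rwa [neg_sq] at this)
    (φ := fun y : κ → σ → B => φ (fun x => y x.2 x.1)) (fun y => h0 _) (fun y => h1 _)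
  rw [← key h] at up
  rw [← key h'] at down
  -- Both inputs are compared with the reference value `expect q φ`, at the price of one factor `exp
  -- t` each.
  have := mul_le_mul_of_nonneg_left down (Real.exp_pos t).le
  linarith

end Symmetrize

/-! ### Randomness of the blanket and the privacy bound. -/

theorem expect_mono_of_support {ι B : Type*} [Fintype ι] [DecidableEq ι] [Fintype B]
    {q : ι → B → ℝ} (hq : ∀ x, IsLaw (q x)) {F G : (ι → B) → ℝ}
    (h : ∀ y, (∀ x, q x (y x) ≠ 0) → F y ≤ G y) : expect q F ≤ expect q G := by
  refine Finset.sum_le_sum fun y _ => ?_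
  by_cases hy : ∀ x, q x (y x) ≠ 0
  · exact mul_le_mul_of_nonneg_left (h y hy) ((isLaw_prodLaw hq).1 y)
  · push Not at hy
    obtain ⟨x, hx⟩ := hy
    have : prodLaw q y = 0 := Finset.prod_eq_zero (Finset.mem_univ x) hx
    simp [this]

section Mixture

variable {σ κ B : Type*} [Fintype σ] [DecidableEq σ] [Fintype κ] [DecidableEq κ] [Fintype B]

/-- Changing the laws of the symbols of one user amounts to a change of measure. -/
theorem expect_eq_expect_mul_density {p q : σ × κ → B → ℝ} {i : σ} {h : κ → B → ℝ}
    (hi : ∀ a b, p (i, a) b = q (i, a) b * (1 + h a b))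
    (hne : ∀ t a, t ≠ i → p (t, a) = q (t, a)) (φ : (σ × κ → B) → ℝ) :
    expect p φ = expect q (fun y => φ y * ∏ a, (1 + h a (y (i, a)))) := by
  refine Finset.sum_congr rfl fun y _ => ?_
  have : prodLaw p y = prodLaw q y * ∏ a, (1 + h a (y (i, a))) := by
    simp only [prodLaw]
    rw [Fintype.prod_prod_type_right, Fintype.prod_prod_type_right, ← Finset.prod_mul_distrib]
    refine Finset.prod_congr rfl fun a _ => ?_
    rw [← Finset.mul_prod_erase _ _ (Finset.mem_univ i),
      ← Finset.mul_prod_erase _ (fun t => q (t, a) (y (t, a))) (Finset.mem_univ i), hi,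
      Finset.prod_congr rfl fun t ht => by rw [hne t a (Finset.ne_of_mem_erase ht)]]
    ring
  rw [this]
  ring

/-- The ratio has total mass one, so coin outcomes with too small a blanket contribute at most their
probability. -/
theorem expect_density {q : σ × κ → B → ℝ} (hq : ∀ x, IsLaw (q x)) (i : σ) {h : κ → B → ℝ}
    (hmean : ∀ a, ∑ b, q (i, a) b * h a b = 0) :
    expect q (fun y => ∏ a, (1 + h a (y (i, a)))) = 1 := by
  have := expect_prod q (fun x b => if x.1 = i then 1 + h x.2 b else 1)
  simp only [Fintype.prod_prod_type_right, Finset.prod_ite_eq', Finset.mem_univ, if_true] at this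
  rw [this]
  refine Finset.prod_eq_one fun a _ => Finset.prod_eq_one fun t _ => ?_
  by_cases ht : t = i
  · subst ht
    simp [mul_add, Finset.sum_add_distrib, hmean, (hq _).2]
  · simp [ht, (hq _).2]

/-- The lower tail of a sum of independent Bernoulli variables. -/
theorem expect_card_lt_le {Γ : σ × κ → ℝ} (hΓ0 : ∀ x, 0 ≤ Γ x) (hΓ1 : ∀ x, Γ x ≤ 1) (a : κ)
    {γ m : ℝ} (hγ : ∀ t, γ ≤ Γ (t, a)) (hm : m ≤ Fintype.card σ * γ / 4) :
    expect (fun x => bernoulliLaw (Γ x))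
        (fun c => if ((Finset.univ.filter fun t => c (t, a) = true).card : ℝ) < m then 1 else 0)
      ≤ Real.exp (-(Fintype.card σ * γ / 4)) := by
  have hl : ∀ x, IsLaw (bernoulliLaw (Γ x)) := fun x => isLaw_bernoulliLaw (hΓ0 x) (hΓ1 x)
  -- Chernoff bound with parameter `-1`: each user contributes `1 - γ * (1 - exp (-1)) ≤ exp (-(γ /
  -- 2))`, and the threshold `m` returns at most half of the exponent.
  set g : σ × κ → Bool → ℝ := fun x c => if x.2 = a ∧ c = true then Real.exp (-1) else 1 with hg
  calc _ ≤ expect (fun x => bernoulliLaw (Γ x)) (fun c => Real.exp m *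
          ∏ x : σ × κ, g x (c x)) := by
        refine expect_mono hl fun c => ?_
        have : (∏ x : σ × κ, g x (c x))
            = Real.exp (-((Finset.univ.filter fun t => c (t, a) = true).card : ℝ)) := by
          rw [Fintype.prod_prod_type_right, Finset.prod_eq_single a]
          · simp only [hg, true_and]
            rw [Finset.prod_ite]
            simp [← Real.exp_nat_mul]
          · intro a' _ ha
            simp [hg, ha]
          · simp
        rw [this, ← Real.exp_add]
        split_ifs with h
        · exact Real.one_le_exp (by linarith)
        · positivity
    _ ≤ Real.exp m * ∏ _t : σ, Real.exp (-(γ / 2)) := by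
        rw [expect_const_mul, expect_prod _ g, Fintype.prod_prod_type_right, Finset.prod_eq_single a]
        · gcongr with t
          · intro t _
            refine Finset.sum_nonneg fun b _ => mul_nonneg ((hl _).1 b) ?_
            simp only [hg]
            split_ifs <;> positivity
          · have h1 : Real.exp (-1) ≤ 1 / 2 := by
              rw [Real.exp_neg, inv_le_comm₀ (Real.exp_pos _) (by norm_num)]
              linarith [Real.add_one_le_exp (1 : ℝ)]
            simp [hg, bernoulliLaw]
            have := Real.add_one_le_exp (-(γ / 2))
            nlinarith [hγ t, hΓ0 (t, a)]
        · intro a' _ ha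
          refine Finset.prod_eq_one fun t _ => ?_
          simp [hg, ha, bernoulliLaw]
        · simp
    _ ≤ _ := by
        rw [Finset.prod_const, ← Real.exp_nat_mul, ← Real.exp_add, Finset.card_univ]
        gcongr
        linarith

/-- The parameters are tuned so that `μ * (ε / 2) = 5 * T`, `ν ^ 2 * ρ = 1` and `ν / (2 * μ) = 10 *
T`. Every error term is then a small multiple of `exp (-T)`, even after a union bound over up to `2
* exp T` rounds. -/
theorem exp_privacy_bound {T ε μ ν ρ δ k : ℝ} (hT : 1 ≤ T) (hε : 0 < ε) (hε1 : ε ≤ 1)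
    (hδ : Real.exp (-T) ≤ δ) (hk0 : 0 ≤ k) (hk : k ≤ 2 * Real.exp T)
    (hμ : μ = 10 * T / ε) (hν : ν = 200 * T ^ 2 / ε) (hρ : ρ = ε ^ 2 / (40000 * T ^ 4)) :
    Real.exp (ε / 2) * (Real.exp (8 * μ ^ 2 * ρ - μ * (ε / 2))
          + 2 * k * Real.exp (ν ^ 2 * ρ - ν / (2 * μ)))
        + Real.exp (μ ^ 2 * ρ - (μ - 1) * (ε / 2)) + k * Real.exp (-(10 * T)) ≤ δ := by
  have hT0 : 0 < T := by linarith
  have e1 : μ * (ε / 2) = 5 * T := by rw [hμ]; field_simp; norm_num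
  have e2 : μ ^ 2 * ρ = 1 / (400 * T ^ 2) := by rw [hμ, hρ]; field_simp; norm_num
  have e3 : ν ^ 2 * ρ = 1 := by rw [hν, hρ]; field_simp; norm_num
  have e4 : ν / (2 * μ) = 10 * T := by rw [hμ, hν]; field_simp; norm_num
  have h5 : 1 / (400 * T ^ 2) ≤ 1 / 400 := by
    gcongr; nlinarith
  rw [mul_assoc 8, e2, e3, e4, sub_mul, e1]
  have hexp : ∀ {x y : ℝ}, x ≤ y → Real.exp x ≤ Real.exp y := fun h => Real.exp_le_exp.2 h
  set w := Real.exp (-T) with hw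
  have hwpos : 0 < w := Real.exp_pos _
  have he2 : Real.exp (ε / 2) ≤ 2 := by
    calc Real.exp (ε / 2) ≤ Real.exp (1 / 2) := hexp (by linarith)
      _ ≤ 2 := by
        have := Real.exp_le_one_add_add_sq (s := 1 / 2) (by norm_num)
        linarith
  have hA : Real.exp (8 * (1 / (400 * T ^ 2)) - 5 * T) ≤ w * Real.exp (-3) := by
    rw [hw, ← Real.exp_add]; exact hexp (by linarith)
  have hB : Real.exp (1 / (400 * T ^ 2) - (5 * T - 1 * (ε / 2))) ≤ w * Real.exp (-3) := by
    rw [hw, ← Real.exp_add]; exact hexp (by linarith)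
  have hC : Real.exp T * Real.exp (1 - 10 * T) ≤ w * Real.exp (-7) := by
    rw [hw, ← Real.exp_add, ← Real.exp_add]; exact hexp (by linarith)
  have hD : Real.exp T * Real.exp (-(10 * T)) ≤ w * Real.exp (-7) := by
    rw [hw, ← Real.exp_add, ← Real.exp_add]; exact hexp (by linarith)
  have hC' : k * Real.exp (1 - 10 * T) ≤ 2 * (w * Real.exp (-7)) := by
    calc _ ≤ (2 * Real.exp T) * Real.exp (1 - 10 * T) := by gcongr
      _ ≤ _ := by rw [mul_assoc]; gcongr
  have hD' : k * Real.exp (-(10 * T)) ≤ 2 * (w * Real.exp (-7)) := by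
    calc _ ≤ (2 * Real.exp T) * Real.exp (-(10 * T)) := by gcongr
      _ ≤ _ := by rw [mul_assoc]; gcongr
  have hE : ∀ n : ℕ, Real.exp (-n) ≤ (1 / 2) ^ n := fun n => by
    have h1 : Real.exp (-1) ≤ 1 / 2 := by
      rw [Real.exp_neg, inv_le_comm₀ (Real.exp_pos _) (by norm_num)]
      linarith [Real.add_one_le_exp (1 : ℝ)]
    calc Real.exp (-n) = Real.exp (-1) ^ n := by rw [← Real.exp_nat_mul]; ring_nf
      _ ≤ _ := by gcongr
  have h3 : Real.exp (-3) ≤ 1 / 8 := by have := hE 3; norm_num at this ⊢; exact this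
  have h7 : Real.exp (-7) ≤ 1 / 128 := by have := hE 7; norm_num at this ⊢; exact this
  have hA' : w * Real.exp (-3) ≤ w / 8 := by nlinarith
  have hC7 : w * Real.exp (-7) ≤ w / 128 := by nlinarith
  have : Real.exp (ε / 2) * (Real.exp (8 * (1 / (400 * T ^ 2)) - 5 * T)
          + 2 * k * Real.exp (1 - 10 * T)) ≤ 2 * (w / 8 + 4 * (w / 128)) := by
    refine mul_le_mul he2 ?_ (by positivity) (by norm_num)
    linarith
  linarith

/-- Privacy amplification by shuffling: if the laws of all users other than `i` contain a blanket
of the reference laws `U a` with respect to which the laws of user `i` on two inputs have densities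
`1 + h a` and `1 + h' a`, then permutation invariant tests hardly distinguish the two inputs. -/
theorem expect_le_of_blanket {p p' : σ × κ → B → ℝ} {i : σ} {U : κ → B → ℝ} {R : σ × κ → B → ℝ}
    {γ : κ → ℝ} (hU : ∀ a, IsLaw (U a)) (hR : ∀ x, IsLaw (R x))
    (hγ0 : ∀ a, 0 ≤ γ a) (hγ1 : ∀ a, γ a ≤ 1)
    {h h' : κ → B → ℝ}
    (hp : ∀ t a, t ≠ i → ∀ b, p (t, a) b = γ a * U a b + (1 - γ a) * R (t, a) b)
    (hp' : ∀ t a, t ≠ i → ∀ b, p' (t, a) b = γ a * U a b + (1 - γ a) * R (t, a) b)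
    (hpi : ∀ a b, p (i, a) b = U a b * (1 + h a b))
    (hpi' : ∀ a b, p' (i, a) b = U a b * (1 + h' a b))
    {φ : (σ × κ → B) → ℝ}
    (hφ : ∀ (e : Equiv.Perm (σ × κ)) y, φ (y ∘ e) = φ y) (h0 : ∀ y, 0 ≤ φ y) (h1 : ∀ y, φ y ≤ 1)
    {V H m : κ → ℝ} {T ε δ : ℝ}
    (hge : ∀ a b, -1 ≤ h a b) (hge' : ∀ a b, -1 ≤ h' a b)
    (hmean : ∀ a, ∑ b, U a b * h a b = 0) (hmean' : ∀ a, ∑ b, U a b * h' a b = 0)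
    (hV : ∀ a, ∑ b, U a b * h a b ^ 2 ≤ V a) (hV' : ∀ a, ∑ b, U a b * h' a b ^ 2 ≤ V a)
    (hH : ∀ a b, |h a b| ≤ H a) (hH' : ∀ a b, |h' a b| ≤ H a)
    (hT : 1 ≤ T) (hε : 0 < ε) (hε1 : ε ≤ 1) (hδ : Real.exp (-T) ≤ δ)
    (hk : (Fintype.card κ : ℝ) ≤ 2 * Real.exp T)
    (hm0 : ∀ a, 0 < m a)
    (hm : ∀ a, m a ≤ 1 ∨ (m a ≤ Fintype.card σ * γ a / 4 ∧ 40 * T ≤ Fintype.card σ * γ a))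
    (hρ : ∑ a, V a / m a ≤ ε ^ 2 / (40000 * T ^ 4))
    (hν : ∀ a, 200 * T ^ 2 * H a ≤ ε * m a) :
    expect p φ ≤ Real.exp ε * expect p' φ + δ := by
  classical
  -- User `i` gets coin probability one: under `q` this user draws from `U a`, and the true input
  -- enters only through the density.
  set Γ : σ × κ → ℝ := fun x => if x.1 = i then 1 else γ x.2 with hΓ
  have hΓ0 : ∀ x, 0 ≤ Γ x := fun x => by
    simp only [hΓ]; split_ifs <;> simp [hγ0]
  have hΓ1 : ∀ x, Γ x ≤ 1 := fun x => by
    simp only [hΓ]; split_ifs <;> simp [hγ1]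
  set q : σ × κ → B → ℝ := fun x b => Γ x * U x.2 b + (1 - Γ x) * R x b with hq
  have hqi : ∀ a b, q (i, a) b = U a b := fun a b => by simp [hq, hΓ]
  have hqt : ∀ t a, t ≠ i → ∀ b, q (t, a) b = γ a * U a b + (1 - γ a) * R (t, a) b :=
    fun t a ht b => by simp [hq, hΓ, ht]
  set Q : (σ × κ → Bool) → σ × κ → B → ℝ := fun c x b => if c x then U x.2 b else R x b with hQ
  have hQlaw : ∀ c x, IsLaw (Q c x) := fun c x => by
    by_cases hc : c x = true
    · have : Q c x = U x.2 := by funext b; simp [hQ, hc]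
      rw [this]; exact hU _
    · have : Q c x = R x := by funext b; simp [hQ, hc]
      rw [this]; exact hR _
  have hl : ∀ x, IsLaw (bernoulliLaw (Γ x)) := fun x => isLaw_bernoulliLaw (hΓ0 x) (hΓ1 x)
  have hT0 : 0 < T := by linarith
  set t : ℝ := ε / 2 with ht
  obtain ⟨μ, hμ⟩ : ∃ μ : ℝ, μ = 10 * T / ε := ⟨_, rfl⟩
  obtain ⟨ν, hνd⟩ : ∃ ν : ℝ, ν = 200 * T ^ 2 / ε := ⟨_, rfl⟩
  obtain ⟨ρ, hρd⟩ : ∃ ρ : ℝ, ρ = ε ^ 2 / (40000 * T ^ 4) := ⟨_, rfl⟩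
  have hμ1 : 1 ≤ μ := by rw [hμ, le_div_iff₀ hε]; linarith
  have hμν : μ ≤ ν := by rw [hμ, hνd]; gcongr ?_ / ε; nlinarith
  set X : ℝ := Real.exp (8 * μ ^ 2 * ρ - μ * t)
          + 2 * Fintype.card κ * Real.exp (ν ^ 2 * ρ - ν / (2 * μ)) with hX
  set Y : ℝ := Real.exp (μ ^ 2 * ρ - (μ - 1) * t) with hY
  have hX0 : 0 ≤ X := by positivity
  have hY0 : 0 ≤ Y := by positivity
  set bad : κ → (σ × κ → Bool) → ℝ := fun a c =>
    if ((Finset.univ.filter fun s => c (s, a) = true).card : ℝ) < m a then 1 else 0 with hbad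
  have hbad0 : ∀ a c, 0 ≤ bad a c := fun a c => by simp only [hbad]; split_ifs <;> simp
  have eqp : expect p φ = expect (fun x => bernoulliLaw (Γ x)) (fun c => expect (Q c)
      (fun y => φ y * ∏ a, (1 + h a (y (i, a))))) := by
    rw [expect_eq_expect_mul_density (q := q) (i := i) (h := h)
      (fun a b => by rw [hqi, hpi]) (fun s a hs => funext fun b => by rw [hqt s a hs, hp s a hs])]
    exact expect_mixture Γ (fun x => U x.2) R _
  have eqp' : expect p' φ = expect (fun x => bernoulliLaw (Γ x)) (fun c => expect (Q c)
      (fun y => φ y * ∏ a, (1 + h' a (y (i, a))))) := by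
    rw [expect_eq_expect_mul_density (q := q) (i := i) (h := h')
      (fun a b => by rw [hqi, hpi']) (fun s a hs => funext fun b => by rw [hqt s a hs, hp' s a hs])]
    exact expect_mixture Γ (fun x => U x.2) R _
  have main : expect p φ ≤ expect (fun x => bernoulliLaw (Γ x)) (fun c =>
      (Real.exp ε * expect (Q c) (fun y => φ y * ∏ a, (1 + h' a (y (i, a))))
        + (Real.exp t * X + Y)) + ∑ a, bad a c) := by
    rw [eqp]
    refine expect_mono_of_support hl fun c hc => ?_
    have hci : ∀ a, c (i, a) = true := fun a => by
      by_contra hf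
      have := hc (i, a)
      simp [bernoulliLaw, hf, hΓ] at this
    have hQi : ∀ a b, Q c (i, a) b = U a b := fun a b => by simp [hQ, hci]
    have hexp2 : Real.exp ε = Real.exp t * Real.exp t := by
      rw [← Real.exp_add]; congr 1; rw [ht]; ring
    have hnn : 0 ≤ expect (Q c) (fun y => φ y * ∏ a, (1 + h' a (y (i, a)))) :=
      expect_nonneg (hQlaw c) fun y => mul_nonneg (h0 y)
        (Finset.prod_nonneg fun a _ => by linarith [hge' a (y (i, a))])
    by_cases hgood : ∀ a, m a ≤ ((Finset.univ.filter fun s => c (s, a) = true).card : ℝ)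
    · have key := expect_mul_prod_le_of_blanket (hQlaw c)
        (S := fun a => Finset.univ.filter fun s => c (s, a) = true) (i := i)
        (fun a => by simp [hci]) (fun a s hs => by
          rw [Finset.mem_filter] at hs
          funext b
          simp [hQ, hci, hs.2]) hφ h0 h1 (V := V) (H := H) (ρ := ρ) (μ := μ) (ν := ν) (t := t)
        hge hge' (fun a => by simp only [hQi]; exact hmean a)
        (fun a => by simp only [hQi]; exact hmean' a)
        (fun a => by simp only [hQi]; exact hV a) (fun a => by simp only [hQi]; exact hV' a)
        hH hH'
        (by
          rw [hρd]
          refine le_trans (Finset.sum_le_sum fun a _ => ?_) hρ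
          have : 0 ≤ V a :=
            (Finset.sum_nonneg fun b _ => mul_nonneg ((hU a).1 b) (sq_nonneg _)).trans (hV a)
          exact div_le_div_of_nonneg_left this (hm0 a) (hgood a))
        (fun a => by
          refine le_trans ?_ (hgood a)
          rw [hνd, div_mul_eq_mul_div, div_le_iff₀ hε, mul_comm (m a)]
          exact hν a) hμ1 hμν
      have : 0 ≤ ∑ a, bad a c := Finset.sum_nonneg fun a _ => hbad0 a c
      rw [hexp2]
      simp only [hX, hY]
      linarith
    -- When some blanket is too small, the trivial bound by one is charged to `bad`.
    · push Not at hgood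
      obtain ⟨a, ha⟩ := hgood
      have hb : 1 ≤ ∑ a, bad a c := by
        have := Finset.single_le_sum (f := fun a => bad a c) (fun a _ => hbad0 a c)
          (Finset.mem_univ a)
        have e : bad a c = 1 := by simp only [hbad]; rw [if_pos ha]
        simp only [e] at this
        exact this
      have hle : expect (Q c) (fun y => φ y * ∏ a, (1 + h a (y (i, a)))) ≤ 1 := by
        refine (expect_mono (hQlaw c) fun y => ?_).trans
          (expect_density (hQlaw c) i (h := h) (fun a => by simp only [hQi]; exact hmean a)).le
        exact mul_le_of_le_one_left
          (Finset.prod_nonneg fun a _ => by linarith [hge a (y (i, a))]) (h1 y)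
      have : 0 ≤ Real.exp ε * expect (Q c) (fun y => φ y * ∏ a, (1 + h' a (y (i, a)))) :=
        mul_nonneg (Real.exp_pos _).le hnn
      have : 0 ≤ Real.exp t * X := mul_nonneg (Real.exp_pos _).le hX0
      linarith
  have hbadsum : expect (fun x => bernoulliLaw (Γ x)) (fun c => ∑ a, bad a c)
      ≤ Fintype.card κ * Real.exp (-(10 * T)) := by
    rw [expect_sum]
    calc _ ≤ ∑ _a : κ, Real.exp (-(10 * T)) := Finset.sum_le_sum fun a _ => ?_
      _ = _ := by simp
    -- A threshold of at most one is always met, since user `i` belongs to the blanket. Rounds with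
    -- `γ a = 0` rely on this.
    rcases hm a with hma | ⟨hma, hmb⟩
    · have : expect (fun x => bernoulliLaw (Γ x)) (bad a)
          ≤ expect (fun x => bernoulliLaw (Γ x)) (fun _ => 0) := by
        refine expect_mono_of_support hl fun c hc => ?_
        have hci : c (i, a) = true := by
          by_contra hf
          have := hc (i, a)
          simp [bernoulliLaw, hf, hΓ] at this
        have : 1 ≤ (Finset.univ.filter fun s => c (s, a) = true).card :=
          Finset.card_pos.2 ⟨i, by simp [hci]⟩
        have : (1 : ℝ) ≤ (Finset.univ.filter fun s => c (s, a) = true).card := by exact_mod_cast this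
        simp only [hbad]
        rw [if_neg (by linarith)]
      rw [expect_const hl] at this
      exact this.trans (Real.exp_pos _).le
    · refine (expect_card_lt_le hΓ0 hΓ1 a (γ := γ a) (fun s => ?_) hma).trans ?_
      · simp only [hΓ]; split_ifs <;> simp [hγ1]
      · gcongr; linarith
  rw [expect_add, expect_add, expect_const_mul, ← eqp', expect_const hl] at main
  have := exp_privacy_bound hT hε hε1 hδ (Nat.cast_nonneg (Fintype.card κ)) hk hμ hνd hρd
  simp only [hX, hY] at main
  rw [← ht] at this
  linarith

end Mixture

/-! ### From finite weights to the measures of a shuffle protocol. -/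

/-- The measure with given weights on a finite type. -/
noncomputable def weightMeasure {B : Type*} [Fintype B] [MeasurableSpace B] (q : B → ℝ) :
    Measure B :=
  ∑ b, ENNReal.ofReal (q b) • Measure.dirac b

theorem weightMeasure_singleton {B : Type*} [Fintype B] [MeasurableSpace B]
    [MeasurableSingletonClass B] (q : B → ℝ) (b : B) :
    weightMeasure q {b} = ENNReal.ofReal (q b) := by
  classical
  simp only [weightMeasure, Measure.finsetSum_apply, Measure.smul_apply, Measure.dirac_apply,
    smul_eq_mul]
  rw [Finset.sum_eq_single b]
  · simp
  · intro b' _ hb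
    simp [hb]
  · simp

theorem isProbabilityMeasure_weightMeasure {B : Type*} [Fintype B] [MeasurableSpace B] {q : B → ℝ}
    (hq : IsLaw q) : IsProbabilityMeasure (weightMeasure q) := by
  constructor
  simp only [weightMeasure, Measure.finsetSum_apply, Measure.smul_apply, measure_univ, smul_eq_mul,
    mul_one]
  rw [← ENNReal.ofReal_sum_of_nonneg fun b _ => hq.1 b, hq.2, ENNReal.ofReal_one]

namespace ShuffleProtocol

variable {n d k : ℕ}

section Discrete

variable (P : ShuffleProtocol n d k) [Fintype P.Msg] [MeasurableSingletonClass P.Msg]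

theorem lintegral_messages {v : Fin n → UnitSphere d} {p : Fin n × Fin k → P.Msg → ℝ}
    (hp : ∀ x, IsLaw (p x))
    (hP : ∀ i, P.randomizer (v i) = Measure.pi fun a => weightMeasure (p (i, a)))
    {f : (Fin n × Fin k → P.Msg) → ℝ} (hf : ∀ y, 0 ≤ f y) :
    ∫⁻ y, ENNReal.ofReal (f y) ∂P.messages v = ENNReal.ofReal (expect p f) := by
  have : ∀ x, IsProbabilityMeasure (weightMeasure (p x)) := fun x =>
    isProbabilityMeasure_weightMeasure (hp x)
  rw [messages, lintegral_map Measurable.of_discrete (by fun_prop), lintegral_fintype, expect,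
    ENNReal.ofReal_sum_of_nonneg fun y _ => mul_nonneg ((isLaw_prodLaw hp).1 y) (hf y)]
  refine Fintype.sum_equiv (Equiv.curry _ _ _).symm _ _ fun m => ?_
  rw [Measure.pi_singleton]
  simp only [hP, Measure.pi_singleton, weightMeasure_singleton]
  rw [ENNReal.ofReal_mul ((isLaw_prodLaw hp).1 _), mul_comm, prodLaw,
    ENNReal.ofReal_prod_of_nonneg fun x _ => (hp x).1 _, Fintype.prod_prod_type]
  rfl

theorem lintegral_shuffled (v : Fin n → UnitSphere d) (F : (Fin n × Fin k → P.Msg) → ℝ≥0∞) :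
    ∫⁻ y, F y ∂P.shuffled v = (Fintype.card (Equiv.Perm (Fin n × Fin k)) : ℝ≥0∞)⁻¹ *
      ∑ σ : Equiv.Perm (Fin n × Fin k), ∫⁻ y, F (y ∘ σ) ∂P.messages v := by
  rw [shuffled, shuffle, lintegral_smul_measure, lintegral_finsetSum_measure, smul_eq_mul]
  congr 1
  exact Finset.sum_congr rfl fun σ _ => lintegral_map Measurable.of_discrete Measurable.of_discrete

/-- Sums over all messages do not see the permutation, so their error can be computed before
shuffling. -/
theorem lintegral_shuffled_of_invariant {v : Fin n → UnitSphere d}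
    {F : (Fin n × Fin k → P.Msg) → ℝ≥0∞}
    (hF : ∀ (e : Equiv.Perm (Fin n × Fin k)) y, F (y ∘ e) = F y) :
    ∫⁻ y, F y ∂P.shuffled v = ∫⁻ y, F y ∂P.messages v := by
  rw [lintegral_shuffled]
  simp only [hF, Finset.sum_const, Finset.card_univ, nsmul_eq_mul]
  rw [← mul_assoc, ENNReal.inv_mul_cancel (by exact_mod_cast Fintype.card_ne_zero)
    (ENNReal.natCast_ne_top _), one_mul]

/-- The probability that the shuffled messages lie in `U`, given the messages. -/
noncomputable def shuffleTest {ι Z : Type*} [Fintype ι] [DecidableEq ι] (U : Set (ι → Z))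
    (y : ι → Z) : ℝ :=
  (Fintype.card (Equiv.Perm ι) : ℝ)⁻¹ * ∑ σ : Equiv.Perm ι, U.indicator (fun _ => 1) (y ∘ σ)

theorem shuffleTest_comp_perm {ι Z : Type*} [Fintype ι] [DecidableEq ι] (U : Set (ι → Z))
    (e : Equiv.Perm ι) (y : ι → Z) : shuffleTest U (y ∘ e) = shuffleTest U y := by
  simp only [shuffleTest]
  congr 1
  exact Fintype.sum_equiv (Equiv.mulLeft e) _ _ fun σ => rfl

theorem shuffleTest_nonneg {ι Z : Type*} [Fintype ι] [DecidableEq ι] (U : Set (ι → Z))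
    (y : ι → Z) : 0 ≤ shuffleTest U y :=
  mul_nonneg (by positivity)
    (Finset.sum_nonneg fun _ _ => Set.indicator_nonneg (fun _ _ => zero_le_one) _)

theorem shuffleTest_le_one {ι Z : Type*} [Fintype ι] [DecidableEq ι] (U : Set (ι → Z))
    (y : ι → Z) : shuffleTest U y ≤ 1 := by
  have hc : (0 : ℝ) < Fintype.card (Equiv.Perm ι) := by exact_mod_cast Fintype.card_pos
  rw [shuffleTest, inv_mul_eq_div, div_le_one hc]
  calc _ ≤ ∑ _σ : Equiv.Perm ι, (1 : ℝ) := Finset.sum_le_sum fun σ _ =>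
        Set.indicator_le_self' (fun _ _ => zero_le_one) _
    _ = _ := by simp

theorem shuffled_apply {v : Fin n → UnitSphere d} {p : Fin n × Fin k → P.Msg → ℝ}
    (hp : ∀ x, IsLaw (p x))
    (hP : ∀ i, P.randomizer (v i) = Measure.pi fun a => weightMeasure (p (i, a)))
    (U : Set (Fin n × Fin k → P.Msg)) :
    P.shuffled v U = ENNReal.ofReal (expect p (shuffleTest U)) := by
  have hc : (0 : ℝ) < Fintype.card (Equiv.Perm (Fin n × Fin k)) := by
    exact_mod_cast Fintype.card_pos
  have h1 : ∀ y : Fin n × Fin k → P.Msg,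
      U.indicator (1 : (Fin n × Fin k → P.Msg) → ℝ≥0∞) y = ENNReal.ofReal (U.indicator (fun _ => 1) y) := fun y => by
    by_cases hy : y ∈ U <;> simp [hy]
  rw [← lintegral_indicator_one (μ := P.shuffled v) (MeasurableSet.of_discrete (s := U)),
    lintegral_shuffled]
  simp only [h1]
  have h2 : ∀ σ : Equiv.Perm (Fin n × Fin k),
      ∫⁻ y, ENNReal.ofReal (U.indicator (fun _ => (1 : ℝ)) (y ∘ σ)) ∂P.messages v
        = ENNReal.ofReal (expect p fun y => U.indicator (fun _ => (1 : ℝ)) (y ∘ σ)) := fun σ =>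
    P.lintegral_messages hp hP fun y => Set.indicator_nonneg (fun _ _ => zero_le_one) _
  simp only [h2]
  rw [← ENNReal.ofReal_sum_of_nonneg fun σ _ => expect_nonneg hp fun y =>
      Set.indicator_nonneg (fun _ _ => zero_le_one) _, ← expect_sum,
    show shuffleTest U = fun y => (Fintype.card (Equiv.Perm (Fin n × Fin k)) : ℝ)⁻¹ *
      ∑ σ : Equiv.Perm (Fin n × Fin k), U.indicator (fun _ => 1) (y ∘ σ) from rfl,
    expect_const_mul, ENNReal.ofReal_mul (by positivity), ENNReal.ofReal_inv_of_pos hc,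
    ENNReal.ofReal_natCast]

end Discrete

end ShuffleProtocol

/-! ### Protocols consisting of tagged rounds. -/

/-- The law `q` on the symbols, tagged with the round `a`. -/
def tagLaw {κ B : Type*} [DecidableEq κ] (a : κ) (q : B → ℝ) (m : κ × B) : ℝ :=
  if m.1 = a then q m.2 else 0

theorem sum_tagLaw_mul {κ B : Type*} [Fintype κ] [DecidableEq κ] [Fintype B] (a : κ) (q : B → ℝ)
    (f : κ × B → ℝ) : ∑ m, tagLaw a q m * f m = ∑ b, q b * f (a, b) := by
  rw [Fintype.sum_prod_type, Finset.sum_eq_single a]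
  · simp [tagLaw]
  · intro a' _ ha
    simp [tagLaw, ha]
  · simp

theorem isLaw_tagLaw {κ B : Type*} [Fintype κ] [DecidableEq κ] [Fintype B] (a : κ) {q : B → ℝ}
    (hq : IsLaw q) : IsLaw (tagLaw a q) := by
  refine ⟨fun m => ?_, ?_⟩
  · rw [tagLaw]; split_ifs
    exacts [hq.1 _, le_rfl]
  · have := sum_tagLaw_mul a q (fun _ => 1)
    simpa [hq.2] using this

namespace ShuffleProtocol

/-- The protocol with finitely many symbols in which a user with input `v` sends in round `a` a
symbol with law `q a v`, tagged with `a`, and the aggregation adds up the values `ψ` of the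
messages. -/
noncomputable def ofRounds {n d k : ℕ} {B : Type} [Fintype B] (q : Fin k → UnitSphere d → B → ℝ)
    (hq : ∀ a v, IsLaw (q a v)) (ψ : Fin k × B → EuclideanSpace ℝ (Fin d)) :
    ShuffleProtocol n d k where
  Msg := Fin k × B
  measurableSpaceMsg := ⊤
  randomizer v :=
    letI : MeasurableSpace (Fin k × B) := ⊤
    Measure.pi fun a => weightMeasure (tagLaw a (q a v))
  isProbabilityMeasure_randomizer v := by
    let : MeasurableSpace (Fin k × B) := ⊤
    have : ∀ a, IsProbabilityMeasure (weightMeasure (tagLaw a (q a v))) := fun a =>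
      isProbabilityMeasure_weightMeasure (isLaw_tagLaw a (hq a v))
    infer_instance
  aggregate m := ∑ x, ψ (m x)
  measurable_aggregate := by
    let : MeasurableSpace (Fin k × B) := ⊤
    exact Measurable.of_discrete

section OfRounds

variable {n d k : ℕ} {B : Type} [Fintype B] {q : Fin k → UnitSphere d → B → ℝ}
  {hq : ∀ a v, IsLaw (q a v)} {ψ : Fin k × B → EuclideanSpace ℝ (Fin d)}

noncomputable instance : Fintype (ofRounds (n := n) q hq ψ).Msg :=
  inferInstanceAs (Fintype (Fin k × B))

instance : DiscreteMeasurableSpace (ofRounds (n := n) q hq ψ).Msg :=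
  ⟨fun _ => trivial⟩

/-- Bias and variance, coordinate by coordinate. The centers `r` are free: zero gives plain second
moments, and a value depending on the input exploits symbols that rarely deviate. -/
theorem ofRounds_err_le {E : ℝ} (r : Fin k → UnitSphere d → Fin d → ℝ)
    (hE : ∀ v : Fin n → UnitSphere d,
      ∑ j, (∑ i, ∑ a, ∑ b, q a (v i) b * (ψ (a, b) j - r a (v i) j) ^ 2
        + (∑ i, (∑ a, ∑ b, q a (v i) b * ψ (a, b) j
            - (v i : EuclideanSpace ℝ (Fin d)) j)) ^ 2) ≤ E) :
    (ofRounds (n := n) q hq ψ).err ≤ ENNReal.ofReal E := by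
  refine iSup_le fun v => ?_
  let P := ofRounds (n := n) q hq ψ
  set p : Fin n × Fin k → P.Msg → ℝ := fun x => tagLaw x.2 (q x.2 (v x.1)) with hp
  have hpl : ∀ x, IsLaw (p x) := fun x => isLaw_tagLaw _ (hq _ _)
  rw [lintegral_shuffled_of_invariant]
  · have h1 : ∀ m : Fin n × Fin k → P.Msg,
        ‖P.aggregate m - ∑ i, (v i : EuclideanSpace ℝ (Fin d))‖ₑ ^ 2
          = ENNReal.ofReal (∑ j, (∑ x, ψ (m x) j
            - ∑ i, (v i : EuclideanSpace ℝ (Fin d)) j) ^ 2) := fun m => by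
      rw [← ofReal_norm, ← ENNReal.ofReal_pow (norm_nonneg _), EuclideanSpace.norm_sq_eq]
      congr 1
      refine Finset.sum_congr rfl fun j _ => ?_
      rw [Real.norm_eq_abs, sq_abs]
      simp [P, ofRounds]
    refine (lintegral_congr h1).trans_le ?_
    rw [lintegral_messages _ (p := p) hpl (fun i => rfl) fun y =>
      Finset.sum_nonneg fun j _ => sq_nonneg _]
    refine ENNReal.ofReal_le_ofReal ?_
    rw [expect_sum]
    refine le_trans (Finset.sum_le_sum fun j _ => ?_) (hE v)
    refine (expect_sub_sq_le hpl (fun _ m => ψ m j) (fun x => r x.2 (v x.1) j) _).trans (le_of_eq ?_)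
    have h2 : ∀ (x : Fin n × Fin k) (f : P.Msg → ℝ),
        ∑ b, p x b * f b = ∑ b, q x.2 (v x.1) b * f (x.2, b) := fun x f => sum_tagLaw_mul _ _ f
    rw [Fintype.sum_prod_type, Fintype.sum_prod_type]
    simp only [h2, Finset.sum_sub_distrib]
  · intro e y
    have : P.aggregate (y ∘ e) = P.aggregate y := Equiv.sum_comp e fun x => ψ (y x)
    change ‖P.aggregate (y ∘ e) - _‖ₑ ^ 2 = ‖P.aggregate y - _‖ₑ ^ 2
    rw [this]

/-- Privacy of a protocol in which the law of every symbol contains a blanket. -/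
theorem ofRounds_isShuffleDP {T ε δ : ℝ} (hT : 1 ≤ T) (hε : 0 < ε) (hε1 : ε ≤ 1)
    (hδ : Real.exp (-T) ≤ δ) (hk : (k : ℝ) ≤ 2 * Real.exp T)
    (hblanket : ∀ v v' : UnitSphere d, ∃ (U : Fin k → B → ℝ) (R : UnitSphere d → Fin k → B → ℝ)
      (γ V H m : Fin k → ℝ) (h h' : Fin k → B → ℝ),
      (∀ a, IsLaw (U a)) ∧ (∀ w a, IsLaw (R w a)) ∧ (∀ a, 0 ≤ γ a) ∧ (∀ a, γ a ≤ 1) ∧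
      (∀ w a b, q a w b = γ a * U a b + (1 - γ a) * R w a b) ∧
      (∀ a b, q a v b = U a b * (1 + h a b)) ∧ (∀ a b, q a v' b = U a b * (1 + h' a b)) ∧
      (∀ a b, -1 ≤ h a b) ∧ (∀ a b, -1 ≤ h' a b) ∧
      (∀ a, ∑ b, U a b * h a b ^ 2 ≤ V a) ∧ (∀ a, ∑ b, U a b * h' a b ^ 2 ≤ V a) ∧
      (∀ a b, |h a b| ≤ H a) ∧ (∀ a b, |h' a b| ≤ H a) ∧
      (∀ a, 0 < m a) ∧ (∀ a, m a ≤ 1 ∨ (m a ≤ n * γ a / 4 ∧ 40 * T ≤ n * γ a)) ∧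
      ∑ a, V a / m a ≤ ε ^ 2 / (40000 * T ^ 4) ∧ ∀ a, 200 * T ^ 2 * H a ≤ ε * m a) :
    (ofRounds (n := n) q hq ψ).IsShuffleDP ε δ := by
  intro D D' ⟨i, hi⟩ W _
  let P := ofRounds (n := n) q hq ψ
  obtain ⟨U, R, γ, V, H, m, h, h', hU, hR, hγ0, hγ1, hmix, hh, hh', hge, hge', hV, hV', hH, hH', hm0,
    hm, hρ, hν⟩ := hblanket (D i) (D' i)
  set p : (Fin n → UnitSphere d) → Fin n × Fin k → P.Msg → ℝ :=
    fun v x => tagLaw x.2 (q x.2 (v x.1)) with hp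
  have hpl : ∀ v x, IsLaw (p v x) := fun v x => isLaw_tagLaw _ (hq _ _)
  have hδ0 : 0 ≤ δ := (Real.exp_pos _).le.trans hδ
  rw [shuffled_apply _ (p := p D) (hpl D) (fun i => rfl) W,
    shuffled_apply _ (p := p D') (hpl D') (fun i => rfl) W,
    ← ENNReal.ofReal_mul (Real.exp_pos ε).le,
    ← ENNReal.ofReal_add (mul_nonneg (Real.exp_pos ε).le
      (expect_nonneg (hpl D') (shuffleTest_nonneg W))) hδ0]
  refine ENNReal.ofReal_le_ofReal ?_
  have hmean : ∀ {g : Fin k → B → ℝ} {w : UnitSphere d},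
      (∀ a b, q a w b = U a b * (1 + g a b)) → ∀ a, ∑ b, U a b * g a b = 0 := fun {g w} hg a => by
    have := (hq a w).2
    simp only [hg, mul_add, mul_one, Finset.sum_add_distrib, (hU a).2] at this
    linarith
  refine expect_le_of_blanket (B := P.Msg) (i := i) (U := fun a => tagLaw a (U a))
    (R := fun x => tagLaw x.2 (R (D x.1) x.2)) (γ := γ) (h := fun a b => h a b.2)
    (h' := fun a b => h' a b.2) (V := V) (H := H) (m := m) (T := T)
    (fun a => isLaw_tagLaw _ (hU a)) (fun x => isLaw_tagLaw _ (hR _ _)) hγ0 hγ1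
    ?_ ?_ ?_ ?_ (fun e y => shuffleTest_comp_perm W e y) (shuffleTest_nonneg W)
    (shuffleTest_le_one W) (fun a b => hge a _) (fun a b => hge' a _)
    (fun a => (sum_tagLaw_mul a (U a) fun b => h a b.2).trans (hmean hh a))
    (fun a => (sum_tagLaw_mul a (U a) fun b => h' a b.2).trans (hmean hh' a))
    (fun a => (sum_tagLaw_mul a (U a) fun b => h a b.2 ^ 2).trans_le (hV a))
    (fun a => (sum_tagLaw_mul a (U a) fun b => h' a b.2 ^ 2).trans_le (hV' a))
    (fun a b => hH a _) (fun a b => hH' a _) hT hε hε1 hδ (by simpa using hk) hm0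
    (by simpa using hm) hρ hν
  · intro t a _ b
    simp only [hp, tagLaw, hmix]
    split_ifs <;> simp
  · intro t a ht b
    simp only [hp, tagLaw, ← hi t ht, hmix]
    split_ifs <;> simp
  · intro a b
    simp only [hp, tagLaw, hh]
    split_ifs <;> simp
  · intro a b
    simp only [hp, tagLaw, hh']
    split_ifs <;> simp

end OfRounds

end ShuffleProtocol

/-! ### Coordinate bounds on the sphere. -/

section UnitSphere

variable {d : ℕ}

theorem UnitSphere.sum_sq (v : UnitSphere d) :
    ∑ j, (v : EuclideanSpace ℝ (Fin d)) j ^ 2 = 1 := by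
  have h1 : ‖(v : EuclideanSpace ℝ (Fin d))‖ = 1 := by simp
  have h2 := EuclideanSpace.norm_sq_eq (v : EuclideanSpace ℝ (Fin d))
  rw [h1] at h2
  simp only [Real.norm_eq_abs, sq_abs] at h2
  rw [← h2]; norm_num

theorem UnitSphere.abs_le_one (v : UnitSphere d) (j : Fin d) :
    |(v : EuclideanSpace ℝ (Fin d)) j| ≤ 1 := by
  rw [← sq_le_one_iff_abs_le_one]
  exact (Finset.single_le_sum (f := fun j => (v : EuclideanSpace ℝ (Fin d)) j ^ 2)
    (fun j _ => sq_nonneg _) (Finset.mem_univ j)).trans v.sum_sq.le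

theorem UnitSphere.sum_abs_le (v : UnitSphere d) :
    ∑ j, |(v : EuclideanSpace ℝ (Fin d)) j| ≤ √d := by
  refine Real.le_sqrt_of_sq_le ?_
  have := sq_sum_le_card_mul_sum_sq (s := Finset.univ)
    (f := fun j => |(v : EuclideanSpace ℝ (Fin d)) j|)
  simpa [v.sum_sq] using this

end UnitSphere

/-! ### Random signed coordinates. -/

section SignedCoordinate

variable {d : ℕ}

/-- The real number `±1` encoded by a Boolean. -/
def boolSign (s : Bool) : ℝ := if s then 1 else -1

/-- The deviation from the uniform law of the law of a random signed coordinate, biased towards the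
vector `v`. -/
noncomputable def coordinateBias (v : UnitSphere d) (b : Fin d × Bool) : ℝ :=
  2 * √d * max (boolSign b.2 * (v : EuclideanSpace ℝ (Fin d)) b.1) 0
    - (∑ j, |(v : EuclideanSpace ℝ (Fin d)) j|) / √d

theorem max_sq_add_max_neg_sq (x : ℝ) : max x 0 ^ 2 + max (-x) 0 ^ 2 = x ^ 2 := by
  rcases le_total x 0 with h | h
  · rw [max_eq_right h, max_eq_left (by linarith)]; ring
  · rw [max_eq_left h, max_eq_right (by linarith)]; ring

theorem sum_abs_div_sqrt_le_one (hd : 1 ≤ d) (v : UnitSphere d) :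
    (∑ j, |(v : EuclideanSpace ℝ (Fin d)) j|) / √d ≤ 1 := by
  have : 0 < √(d : ℝ) := Real.sqrt_pos.2 (by exact_mod_cast hd)
  rw [div_le_one this]
  exact v.sum_abs_le

theorem neg_one_le_coordinateBias (hd : 1 ≤ d) (v : UnitSphere d) (b : Fin d × Bool) :
    -1 ≤ coordinateBias v b := by
  have h1 := sum_abs_div_sqrt_le_one hd v
  have h2 : 0 ≤ 2 * √d * max (boolSign b.2 * (v : EuclideanSpace ℝ (Fin d)) b.1) 0 := by positivity
  rw [coordinateBias]
  linarith

theorem abs_coordinateBias_le (hd : 1 ≤ d) (v : UnitSphere d) (b : Fin d × Bool) :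
    |coordinateBias v b| ≤ 2 * √d := by
  have h1 : 1 ≤ √(d : ℝ) := Real.one_le_sqrt.2 (by exact_mod_cast hd)
  have h2 := neg_one_le_coordinateBias hd v b
  have h3 : 0 ≤ (∑ j, |(v : EuclideanSpace ℝ (Fin d)) j|) / √d := by positivity
  have h4 : max (boolSign b.2 * (v : EuclideanSpace ℝ (Fin d)) b.1) 0 ≤ 1 := by
    have := abs_le.1 (v.abs_le_one b.1)
    refine max_le ?_ zero_le_one
    rcases b.2 <;> simp [boolSign] <;> linarith
  rw [abs_le]
  constructor
  · linarith
  · rw [coordinateBias]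
    nlinarith

theorem sum_coordinateBias (hd : 1 ≤ d) (v : UnitSphere d) : ∑ b, coordinateBias v b = 0 := by
  have h1 : √(d : ℝ) ^ 2 = d := Real.sq_sqrt (Nat.cast_nonneg d)
  have h2 : 0 < √(d : ℝ) := Real.sqrt_pos.2 (by exact_mod_cast hd)
  have h3 : ∀ j : Fin d, ∑ s, coordinateBias v (j, s)
      = 2 * √d * |(v : EuclideanSpace ℝ (Fin d)) j|
        - 2 * ((∑ j, |(v : EuclideanSpace ℝ (Fin d)) j|) / √d) := fun j => by
    rw [← max_zero_add_max_neg_zero_eq_abs_self]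
    simp only [coordinateBias, boolSign, Fintype.sum_bool, if_true, one_mul, Bool.false_eq_true,
      if_false, neg_one_mul]
    ring
  rw [Fintype.sum_prod_type]
  simp only [h3, Finset.sum_sub_distrib, ← Finset.mul_sum, Finset.sum_const, Finset.card_univ,
    Fintype.card_fin, nsmul_eq_mul]
  field_simp
  rw [h1]
  ring

/-- Divided by the `2 * d` symbols, this is a variance of at most `3`, independent of the dimension,
although single values of the bias can reach order `√d`. The variance determines the privacy cost
and the supremum enters only as a side condition. -/
theorem sum_coordinateBias_sq_le (hd : 1 ≤ d) (v : UnitSphere d) :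
    ∑ b, coordinateBias v b ^ 2 ≤ 6 * d := by
  have h1 : √(d : ℝ) ^ 2 = d := Real.sq_sqrt (Nat.cast_nonneg d)
  have h0 : 0 ≤ (∑ j, |(v : EuclideanSpace ℝ (Fin d)) j|) / √d := by positivity
  have h2 := sum_abs_div_sqrt_le_one hd v
  have h3 : ∀ j : Fin d, ∑ s, coordinateBias v (j, s) ^ 2
      ≤ 4 * d * (v : EuclideanSpace ℝ (Fin d)) j ^ 2 + 2 := fun j => by
    rw [← max_sq_add_max_neg_sq, ← h1]
    have hx : 0 ≤ max ((v : EuclideanSpace ℝ (Fin d)) j) 0 := le_max_right _ _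
    have hy : 0 ≤ max (-(v : EuclideanSpace ℝ (Fin d)) j) 0 := le_max_right _ _
    simp only [coordinateBias, boolSign, Fintype.sum_bool, if_true, one_mul, Bool.false_eq_true,
      if_false, neg_one_mul]
    generalize (∑ j, |(v : EuclideanSpace ℝ (Fin d)) j|) / √d = c at *
    have hz : 0 ≤ √(d : ℝ) := Real.sqrt_nonneg _
    have := mul_nonneg (mul_nonneg hz hx) h0
    have := mul_nonneg (mul_nonneg hz hy) h0
    nlinarith
  rw [Fintype.sum_prod_type]
  refine (Finset.sum_le_sum fun j _ => h3 j).trans (le_of_eq ?_)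
  rw [Finset.sum_add_distrib, ← Finset.mul_sum, v.sum_sq]
  simp
  ring

/-- The law of a random signed coordinate with bias `p` towards `v`. -/
noncomputable def coordinateLaw (p : ℝ) (v : UnitSphere d) (b : Fin d × Bool) : ℝ :=
  (2 * (d : ℝ))⁻¹ * (1 + p * coordinateBias v b)

theorem isLaw_coordinateLaw (hd : 1 ≤ d) {p : ℝ} (hp0 : 0 ≤ p) (hp1 : p ≤ 1) (v : UnitSphere d) :
    IsLaw (coordinateLaw p v) := by
  have hd' : (d : ℝ) ≠ 0 := by positivity
  refine ⟨fun b => mul_nonneg (by positivity) ?_, ?_⟩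
  · nlinarith [neg_one_le_coordinateBias hd v b]
  · simp only [coordinateLaw, ← Finset.mul_sum, Finset.sum_add_distrib, sum_coordinateBias hd v]
    simp
    field_simp

/-- The protocol in which every user sends `k` random signed coordinates. -/
theorem exists_protocol_of_signed_coordinates {n k : ℕ} (hd : 1 ≤ d) {T ε δ : ℝ}
    (hT : 1 ≤ T) (hε : 0 < ε) (hε1 : ε ≤ 1) (hδ : Real.exp (-T) ≤ δ)
    (hk : (k : ℝ) ≤ 2 * Real.exp T) (hnk : n * ε ^ 2 ≤ k)
    (hn : 1600 * T ^ 2 * √d ≤ n * ε) :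
    ∃ P : ShuffleProtocol n d k, P.IsShuffleDP ε δ ∧
      P.err ≤ ENNReal.ofReal (960000 * T ^ 4 * (d / ε ^ 2)) := by
  have hd0 : (0 : ℝ) < d := by exact_mod_cast hd
  have hD1 : 1 ≤ √(d : ℝ) := Real.one_le_sqrt.2 (by exact_mod_cast hd)
  have hD2 : √(d : ℝ) ^ 2 = d := Real.sq_sqrt (Nat.cast_nonneg d)
  have hT2 : 1 ≤ T ^ 2 := one_le_pow₀ hT
  have hT4 : 1 ≤ T ^ 4 := one_le_pow₀ hT
  have hnε : 1600 * T ^ 2 ≤ n * ε := by nlinarith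
  have hn' : 1600 * T ^ 2 ≤ n := by nlinarith [(Nat.cast_nonneg n : (0 : ℝ) ≤ n)]
  have hn0 : (0 : ℝ) < n := by nlinarith
  have hk0 : (0 : ℝ) < k := lt_of_lt_of_le (by positivity) hnk
  -- The largest bias the privacy budget allows: `k` rounds of variance `3 * p ^ 2` over blankets of
  -- size `n / 8` cost `24 * k * p ^ 2 / n`, which must equal `ε ^ 2 / (40000 * T ^ 4)`. The
  -- hypothesis `n * ε ^ 2 ≤ k` makes `p ≤ 1 / 2`.
  obtain ⟨p, hp⟩ : ∃ p : ℝ, p = √(n * ε ^ 2 / (k * (960000 * T ^ 4))) := ⟨_, rfl⟩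
  have hp0 : 0 < p := by rw [hp]; positivity
  have hp2 : p ^ 2 = n * ε ^ 2 / (k * (960000 * T ^ 4)) := by
    rw [hp]; exact Real.sq_sqrt (by positivity)
  have hp1 : p ≤ 1 / 2 := by
    have : p ^ 2 ≤ (1 / 2) ^ 2 := by
      rw [hp2, div_le_iff₀ (by positivity)]
      nlinarith
    exact le_of_sq_le_sq this (by norm_num)
  have hkp : k * p ^ 2 = n * ε ^ 2 / (960000 * T ^ 4) := by rw [hp2]; field_simp
  set ψ : Fin k × (Fin d × Bool) → EuclideanSpace ℝ (Fin d) := fun m =>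
    WithLp.toLp 2 fun j => if j = m.2.1 then √d / (k * p) * boolSign m.2.2 else 0 with hψ
  have hlaw : ∀ v : UnitSphere d, IsLaw (coordinateLaw p v) := fun v =>
    isLaw_coordinateLaw hd hp0.le (by linarith) v
  refine ⟨ShuffleProtocol.ofRounds (fun _ v => coordinateLaw p v) (fun _ v => hlaw v) ψ, ?_, ?_⟩
  -- The reference law is uniform, with weight `1 - p` in every user's law and the fully biased law
  -- as remainder. Since `1 - p ≥ 1 / 2`, blankets of size `n / 8` are available.
  · refine ShuffleProtocol.ofRounds_isShuffleDP hT hε hε1 hδ hk fun v v' =>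
      ⟨fun _ _ => (2 * (d : ℝ))⁻¹, fun w _ => coordinateLaw 1 w, fun _ => 1 - p,
      fun _ => 3 * p ^ 2, fun _ => 2 * √d * p, fun _ => n / 8,
      fun _ b => p * coordinateBias v b, fun _ b => p * coordinateBias v' b,
      ?_, fun w _ => isLaw_coordinateLaw hd zero_le_one le_rfl w, fun _ => by linarith,
      fun _ => by linarith, ?_, fun _ b => rfl, fun _ b => rfl, ?_, ?_, ?_, ?_, ?_, ?_, ?_, ?_, ?_, ?_⟩
    · intro _
      refine ⟨fun b => by positivity, ?_⟩
      simp
      field_simp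
    · intro w _ b
      simp only [coordinateLaw]
      ring
    · intro _ b
      nlinarith [neg_one_le_coordinateBias hd v b]
    · intro _ b
      nlinarith [neg_one_le_coordinateBias hd v' b]
    · intro _
      simp only [mul_pow, ← Finset.mul_sum]
      calc (2 * (d : ℝ))⁻¹ * (p ^ 2 * ∑ b, coordinateBias v b ^ 2)
          ≤ (2 * (d : ℝ))⁻¹ * (p ^ 2 * (6 * d)) := by
            gcongr; exact sum_coordinateBias_sq_le hd v
        _ = 3 * p ^ 2 := by field_simp; norm_num
    · intro _
      simp only [mul_pow, ← Finset.mul_sum]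
      calc (2 * (d : ℝ))⁻¹ * (p ^ 2 * ∑ b, coordinateBias v' b ^ 2)
          ≤ (2 * (d : ℝ))⁻¹ * (p ^ 2 * (6 * d)) := by
            gcongr; exact sum_coordinateBias_sq_le hd v'
        _ = 3 * p ^ 2 := by field_simp; norm_num
    · intro _ b
      rw [abs_mul, abs_of_pos hp0, mul_comm]
      exact mul_le_mul_of_nonneg_right (abs_coordinateBias_le hd v b) hp0.le
    · intro _ b
      rw [abs_mul, abs_of_pos hp0, mul_comm]
      exact mul_le_mul_of_nonneg_right (abs_coordinateBias_le hd v' b) hp0.le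
    · intro _; positivity
    · intro _
      right
      constructor <;> nlinarith
    · simp only [Finset.sum_const, Finset.card_univ, Fintype.card_fin, nsmul_eq_mul]
      have : (k : ℝ) * (3 * p ^ 2 / (n / 8)) = 24 * (k * p ^ 2) / n := by field_simp; norm_num
      rw [this, hkp]
      apply le_of_eq
      field_simp
      norm_num
    · intro _
      have : 200 * T ^ 2 * (2 * √d * p) ≤ 200 * T ^ 2 * (2 * √d * (1 / 2)) := by gcongr
      linarith
  -- The estimate is unbiased, and every message has the same squared norm `d / (k * p) ^ 2`, so
  -- second moments about zero are enough.
  · refine ShuffleProtocol.ofRounds_err_le (fun _ _ _ => 0) fun v => ?_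
    have hmean : ∀ (w : UnitSphere d) (a : Fin k) (j : Fin d),
        ∑ b, coordinateLaw p w b * ψ (a, b) j = (w : EuclideanSpace ℝ (Fin d)) j / k := by
      intro w a j
      rw [Fintype.sum_prod_type, Finset.sum_eq_single j]
      · have h1 := max_zero_sub_eq_self ((w : EuclideanSpace ℝ (Fin d)) j)
        have h2 : (w : EuclideanSpace ℝ (Fin d)) j / k = (2 * (d : ℝ))⁻¹ * (p * (2 * √d *
          (max ((w : EuclideanSpace ℝ (Fin d)) j) 0 - max (-(w : EuclideanSpace ℝ (Fin d)) j) 0)))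
          * (√d / (k * p)) := by
          rw [h1]
          field_simp
          rw [hD2]
        rw [h2]
        simp only [hψ, coordinateLaw, coordinateBias, boolSign, Fintype.sum_bool, if_true, one_mul,
          Bool.false_eq_true, if_false, neg_one_mul]
        ring
      · intro j' _ hj
        simp [hψ, hj.symm]
      · simp
    have hsq : ∀ (w : UnitSphere d) (a : Fin k),
        ∑ j, ∑ b, coordinateLaw p w b * (ψ (a, b) j - 0) ^ 2 = d / (k * p) ^ 2 := by
      intro w a
      rw [Finset.sum_comm]
      have : ∀ b : Fin d × Bool, ∑ j, coordinateLaw p w b * (ψ (a, b) j - 0) ^ 2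
          = coordinateLaw p w b * (d / (k * p) ^ 2) := fun b => by
        rw [Finset.sum_eq_single b.1]
        · have : boolSign b.2 ^ 2 = 1 := by rcases b.2 <;> simp [boolSign]
          simp [hψ, mul_pow, this, div_pow, hD2]
        · intro j _ hj
          simp [hψ, hj]
        · simp
      simp only [this, ← Finset.sum_mul, (hlaw w).2, one_mul]
    simp only [hmean]
    have hb : ∀ j, (∑ i, (∑ _a : Fin k, (v i : EuclideanSpace ℝ (Fin d)) j / k
        - (v i : EuclideanSpace ℝ (Fin d)) j)) ^ 2 = 0 := fun j => by
      rw [Finset.sum_eq_zero fun i _ => ?_]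
      · norm_num
      · simp
        field_simp
        simp
    simp only [hb, add_zero]
    rw [Finset.sum_comm]
    have : ∀ i, ∑ j, ∑ a : Fin k, ∑ b, coordinateLaw p (v i) b * (ψ (a, b) j - 0) ^ 2
        = k * (d / (k * p) ^ 2) := fun i => by
      rw [Finset.sum_comm]
      simp only [hsq]
      simp
    simp only [this]
    simp only [Finset.sum_const, Finset.card_univ, Fintype.card_fin, nsmul_eq_mul]
    have h1 : (n : ℝ) * (k * (d / (k * p) ^ 2)) = n * d / (k * p ^ 2) := by field_simp
    rw [h1, hkp]
    apply le_of_eq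
    field_simp

end SignedCoordinate

/-! ### Signed binary digits and their sparsity. -/

section Digit

/-- The signed binary digit of weight `2⁻ˡ` of a real number in `[-1, 1]`. -/
noncomputable def signedDigit (l : ℕ) (x : ℝ) : SignType :=
  if ⌊2 ^ l * |x|⌋₊ % 2 = 1 then SignType.sign x else 0

/-- Induction on the precision: the digit at level `K + 1` is the remainder of `⌊2 ^ (K + 1) * x⌋₊`
modulo `2`, whose half is `⌊2 ^ K * x⌋₊`. -/
theorem sum_binary_digit {x : ℝ} (h0 : 0 ≤ x) (h1 : x ≤ 1) (K : ℕ) :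
    ∑ l ∈ Finset.range (K + 1), ((⌊2 ^ l * x⌋₊ % 2 : ℕ) : ℝ) / 2 ^ l = ⌊2 ^ K * x⌋₊ / 2 ^ K := by
  induction K with
  | zero =>
    have : ⌊x⌋₊ < 2 := (Nat.floor_lt h0).2 (by push_cast; linarith)
    simp [Nat.mod_eq_of_lt this]
  | succ K ih =>
    rw [Finset.sum_range_succ, ih]
    have h2 : ⌊2 ^ (K + 1) * x⌋₊ / 2 = ⌊2 ^ K * x⌋₊ := by
      have := Nat.floor_div_natCast (2 ^ (K + 1) * x) 2
      rw [← this]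
      congr 1
      push_cast
      ring
    have h3 := Nat.div_add_mod ⌊2 ^ (K + 1) * x⌋₊ 2
    rw [h2] at h3
    have h4 : (⌊2 ^ (K + 1) * x⌋₊ : ℝ)
        = 2 * ⌊2 ^ K * x⌋₊ + ((⌊2 ^ (K + 1) * x⌋₊ % 2 : ℕ) : ℝ) := by
      exact_mod_cast h3.symm
    rw [h4, pow_succ]
    field_simp

theorem signedDigit_eq (l : ℕ) (x : ℝ) :
    ((signedDigit l x : SignType) : ℝ)
      = ((SignType.sign x : SignType) : ℝ) * ((⌊2 ^ l * |x|⌋₊ % 2 : ℕ) : ℝ) := by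
  rw [signedDigit]
  rcases Nat.mod_two_eq_zero_or_one ⌊2 ^ l * |x|⌋₊ with h | h <;> simp [h]

theorem abs_sum_signedDigit_sub_le {x : ℝ} (hx : |x| ≤ 1) (K : ℕ) :
    |∑ l ∈ Finset.range (K + 1), ((signedDigit l x : SignType) : ℝ) / 2 ^ l - x| ≤ 1 / 2 ^ K := by
  have h2 : (0 : ℝ) < 2 ^ K := by positivity
  have e : ∑ l ∈ Finset.range (K + 1), ((signedDigit l x : SignType) : ℝ) / 2 ^ l - x
      = ((SignType.sign x : SignType) : ℝ) * (⌊2 ^ K * |x|⌋₊ / 2 ^ K - |x|) := by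
    rw [← sum_binary_digit (abs_nonneg x) hx K, mul_sub, sign_mul_abs, Finset.mul_sum]
    simp only [signedDigit_eq, mul_div_assoc]
  rw [e, abs_mul]
  have h3 : |((SignType.sign x : SignType) : ℝ)| ≤ 1 := by
    rcases SignType.sign x <;> simp
  refine (mul_le_of_le_one_left (abs_nonneg _) h3).trans ?_
  have h4 := Nat.floor_le (mul_nonneg h2.le (abs_nonneg x))
  have h5 := Nat.lt_floor_add_one (2 ^ K * |x|)
  have e2 : (⌊2 ^ K * |x|⌋₊ / 2 ^ K - |x| : ℝ) = (⌊2 ^ K * |x|⌋₊ - 2 ^ K * |x|) / 2 ^ K := by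
    field_simp
  rw [e2, abs_div, abs_of_pos h2]
  gcongr
  rw [abs_le]
  constructor <;> linarith

theorem one_le_of_signedDigit_ne_zero {l : ℕ} {x : ℝ} (h : signedDigit l x ≠ 0) :
    1 ≤ 4 ^ l * x ^ 2 := by
  have h1 : ⌊2 ^ l * |x|⌋₊ ≠ 0 := fun h0 => h (by simp [signedDigit, h0])
  have h2 : 1 ≤ 2 ^ l * |x| := (Nat.one_le_floor_iff _).1 (Nat.one_le_iff_ne_zero.2 h1)
  calc (1 : ℝ) ≤ (2 ^ l * |x|) ^ 2 := one_le_pow₀ h2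
    _ = 4 ^ l * x ^ 2 := by
      rw [mul_pow, sq_abs, ← pow_mul, mul_comm l, pow_mul]; norm_num

/-- A nonzero digit of weight `2⁻ˡ` forces the coordinate to be at least `2⁻ˡ` in absolute value,
and the squares of the coordinates add up to one. -/
theorem card_signedDigit_ne_zero_le {d : ℕ} (l : ℕ) (v : UnitSphere d) :
    ∑ j, (if signedDigit l ((v : EuclideanSpace ℝ (Fin d)) j) ≠ 0 then (1 : ℝ) else 0)
      ≤ min ((4 : ℝ) ^ l) d := by
  refine le_min ?_ ?_
  · calc _ ≤ ∑ j, 4 ^ l * (v : EuclideanSpace ℝ (Fin d)) j ^ 2 := by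
          refine Finset.sum_le_sum fun j _ => ?_
          split_ifs with h
          · exact one_le_of_signedDigit_ne_zero h
          · positivity
      _ = _ := by rw [← Finset.mul_sum, v.sum_sq, mul_one]
  · calc _ ≤ ∑ _j : Fin d, (1 : ℝ) := Finset.sum_le_sum fun j _ => by split_ifs <;> simp
      _ = _ := by simp

end Digit

/-! ### Randomized response on three symbols. -/

section RandomizedResponse

/-- Randomized response: a symbol that equals `s` except that, with probability `γ`, it is replaced
by a uniformly random one. -/
noncomputable def responseLaw (γ : ℝ) (s b : SignType) : ℝ :=
  γ * 3⁻¹ + (1 - γ) * if b = s then 1 else 0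

theorem SignType.sum_univ (f : SignType → ℝ) : ∑ b, f b = f 0 + f (-1) + f 1 := by
  have : (Finset.univ : Finset SignType) = {0, -1, 1} := by decide
  rw [this, Finset.sum_insert (by decide), Finset.sum_insert (by decide), Finset.sum_singleton,
    add_assoc]

theorem isLaw_responseLaw {γ : ℝ} (h0 : 0 ≤ γ) (h1 : γ ≤ 1) (s : SignType) :
    IsLaw (responseLaw γ s) := by
  refine ⟨fun b => ?_, ?_⟩
  · have : 0 ≤ 1 - γ := by linarith
    rw [responseLaw]
    positivity
  · simp only [responseLaw, Finset.sum_add_distrib, ← Finset.mul_sum, Finset.sum_ite_eq',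
      Finset.mem_univ, if_true, Finset.sum_const, Finset.card_univ]
    have : Fintype.card SignType = 3 := by decide
    rw [this]
    simp

theorem sum_responseLaw_mul (γ : ℝ) (s : SignType) :
    ∑ b, responseLaw γ s b * (b : ℝ) = (1 - γ) * (s : ℝ) := by
  rw [SignType.sum_univ]
  cases s <;> simp [responseLaw]

/-- Only replaced symbols deviate from `s`, by at most `2`; hence the factor `γ`, which second
moments about zero would not give. -/
theorem sum_responseLaw_mul_sq_le {γ : ℝ} (h0 : 0 ≤ γ) (s : SignType) :
    ∑ b, responseLaw γ s b * ((b : ℝ) - (s : ℝ)) ^ 2 ≤ 4 * γ := by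
  rw [SignType.sum_univ]
  cases s <;> simp [responseLaw] <;> nlinarith

/-- The deviation of randomized response from the uniform law. -/
noncomputable def responseBias (γ : ℝ) (s b : SignType) : ℝ :=
  (1 - γ) * ((if b = s then 3 else 0) - 1)

theorem responseLaw_eq (γ : ℝ) (s b : SignType) :
    responseLaw γ s b = 3⁻¹ * (1 + responseBias γ s b) := by
  rw [responseLaw, responseBias]
  split_ifs <;> ring

theorem abs_responseBias_le {γ : ℝ} (h0 : 0 ≤ γ) (h1 : γ ≤ 1) (s b : SignType) :
    |responseBias γ s b| ≤ 2 := by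
  rw [responseBias, abs_le]
  split_ifs <;> constructor <;> linarith

theorem neg_one_le_responseBias {γ : ℝ} (h0 : 0 ≤ γ) (h1 : γ ≤ 1) (s b : SignType) :
    -1 ≤ responseBias γ s b := by
  rw [responseBias]
  split_ifs <;> linarith

theorem sum_responseBias_sq_le {γ : ℝ} (h0 : 0 ≤ γ) (h1 : γ ≤ 1) (s : SignType) :
    ∑ b, 3⁻¹ * responseBias γ s b ^ 2 ≤ 2 := by
  have : (1 - γ) ^ 2 ≤ 1 := pow_le_one₀ (by linarith) (by linarith)
  rw [SignType.sum_univ]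
  cases s <;> simp [responseBias] <;> nlinarith

end RandomizedResponse

/-! ### The digit protocol. -/

/-- The protocol in which every user sends all signed binary digits of all coordinates, each with
randomized response. -/
theorem exists_protocol_of_digits {n d K : ℕ} (hn : 1 ≤ n) (hd : 1 ≤ d) {T ε δ : ℝ}
    (hT : 1 ≤ T) (hε : 0 < ε) (hε1 : ε ≤ 1) (hδ : Real.exp (-T) ≤ δ)
    (hk : (((K + 1) * d : ℕ) : ℝ) ≤ 2 * Real.exp T) (hK : (K + 1 : ℝ) ≤ 4 * T)
    (hnK : (n : ℝ) ≤ 2 ^ K)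
    (hlarge : 2 * (2560000 * T ^ 5) * d ≤ n * ε ^ 2) :
    ∃ P : ShuffleProtocol n d ((K + 1) * d), P.IsShuffleDP ε δ ∧
      P.err ≤ ENNReal.ofReal ((16 * (4 * T) * (2560000 * T ^ 5) + 1) * (d / ε ^ 2)) := by
  -- Each of the at most `4 * T` levels will cost `16 * ε ^ 2 / M`; this `M` makes the total exactly
  -- the budget `ε ^ 2 / (40000 * T ^ 4)`.
  obtain ⟨M, hM⟩ : ∃ M : ℝ, M = 2560000 * T ^ 5 := ⟨_, rfl⟩
  rw [← hM] at hlarge ⊢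
  have hT2 : 1 ≤ T ^ 2 := one_le_pow₀ hT
  have hMT : 1600 * T ^ 2 ≤ M := by
    rw [hM]
    have : T ^ 2 ≤ T ^ 5 := pow_le_pow_right₀ hT (by norm_num)
    nlinarith
  have hM0 : 0 < M := by nlinarith
  have hn0 : (0 : ℝ) < n := by exact_mod_cast hn
  have hd0 : (0 : ℝ) < d := by exact_mod_cast hd
  have hd1 : (1 : ℝ) ≤ d := by exact_mod_cast hd
  have hε2 : ε ^ 2 ≤ 1 := pow_le_one₀ hε.le hε1
  have hε20 : 0 < ε ^ 2 := by positivity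
  set N : ℕ → ℝ := fun l => min (4 ^ l) d with hN
  have hN1 : ∀ l, 1 ≤ N l := fun l => le_min (one_le_pow₀ (by norm_num)) hd1
  have hNd : ∀ l, N l ≤ d := fun l => min_le_right _ _
  set e : Fin ((K + 1) * d) ≃ Fin (K + 1) × Fin d := finProdFinEquiv.symm with he
  -- The noise is proportional to the sparsity bound `N` of the level, and `hlarge` keeps it at most
  -- `1 / 2`.
  set γ : Fin ((K + 1) * d) → ℝ := fun a => N (e a).1 * M / (n * ε ^ 2) with hγ
  have hnγ : ∀ a, n * γ a = N (e a).1 * M / ε ^ 2 := fun a => by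
    simp only [hγ]; field_simp
  have hγ0 : ∀ a, 0 < γ a := fun a => by
    have := hN1 (e a).1
    simp only [hγ]; positivity
  have hγ2 : ∀ a, γ a ≤ 1 / 2 := fun a => by
    simp only [hγ]
    rw [div_le_iff₀ (by positivity)]
    nlinarith [hNd (e a).1]
  have hγ1 : ∀ a, γ a ≤ 1 := fun a => (hγ2 a).trans (by norm_num)
  have hMle : ∀ a, M ≤ n * γ a := fun a => by
    rw [hnγ, le_div_iff₀ hε20]
    nlinarith [hN1 (e a).1]
  set s : Fin ((K + 1) * d) → UnitSphere d → SignType := fun a v =>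
    signedDigit (e a).1 ((v : EuclideanSpace ℝ (Fin d)) (e a).2) with hs
  have hlaw : ∀ a (v : UnitSphere d), IsLaw (responseLaw (γ a) (s a v)) := fun a v =>
    isLaw_responseLaw (hγ0 a).le (hγ1 a) _
  set ψ : Fin ((K + 1) * d) × SignType → EuclideanSpace ℝ (Fin d) := fun m =>
    WithLp.toLp 2 fun j => if j = (e m.1).2 then (m.2 : ℝ) / (2 ^ ((e m.1).1 : ℕ) * (1 - γ m.1))
      else 0 with hψ
  refine ⟨ShuffleProtocol.ofRounds (fun a v => responseLaw (γ a) (s a v)) hlaw ψ, ?_, ?_⟩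
  · refine ShuffleProtocol.ofRounds_isShuffleDP hT hε hε1 hδ hk fun v v' => ?_
    classical
    -- The rounds in which one of the two inputs has a nonzero digit. In all others both inputs send
    -- the same law.
    set A : Fin ((K + 1) * d) → Prop := fun a => s a v ≠ 0 ∨ s a v' ≠ 0 with hA
    have hquiet : ∀ {a}, ¬ A a → s a v' = s a v := fun {a} ha => by
      simp only [hA, not_or, not_not] at ha
      rw [ha.1, ha.2]
    -- In a quiet round the reference is the common law of the two inputs itself: the densities are
    -- `1`, the cost is zero, and no other user has to contribute to the blanket.
    refine ⟨fun a => if A a then fun _ => 3⁻¹ else responseLaw (γ a) (s a v),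
      fun w a => if A a then responseLaw 0 (s a w) else responseLaw (γ a) (s a w),
      fun a => if A a then γ a else 0, fun a => if A a then 2 else 0, fun a => if A a then 2 else 0,
      fun a => if A a then n * γ a / 4 else 1,
      fun a b => if A a then responseBias (γ a) (s a v) b else 0,
      fun a b => if A a then responseBias (γ a) (s a v') b else 0, ?_⟩
    refine ⟨fun a => ?_, fun w a => ?_, fun a => ?_, fun a => ?_, fun w a b => ?_, fun a b => ?_,
      fun a b => ?_, fun a b => ?_, fun a b => ?_, fun a => ?_, fun a => ?_, fun a b => ?_,
      fun a b => ?_, fun a => ?_, fun a => ?_, ?_, fun a => ?_⟩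
    rotate_left 15
    -- A round in `A` costs `8 * ε ^ 2 / (N * M)`. A level has at most `2 * N` such rounds, counting
    -- both inputs, so `N` cancels.
    · have hterm : ∀ a, (if A a then (2 : ℝ) else 0) / (if A a then n * γ a / 4 else 1)
          ≤ ((if s a v ≠ 0 then (1 : ℝ) else 0) + (if s a v' ≠ 0 then 1 else 0))
            * (8 * ε ^ 2 / (N (e a).1 * M)) := fun a => by
        have hpos : 0 ≤ 8 * ε ^ 2 / (N (e a).1 * M) := by
          have := hN1 (e a).1
          positivity
        by_cases ha : A a
        · simp only [ha, if_true, hnγ]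
          have hone : (1 : ℝ) ≤ (if s a v ≠ 0 then (1 : ℝ) else 0)
              + (if s a v' ≠ 0 then 1 else 0) := by
            rcases ha with h | h
            · rw [if_pos h]; split_ifs <;> norm_num
            · rw [if_pos h]; split_ifs <;> norm_num
          calc _ = 1 * (8 * ε ^ 2 / (N (e a).1 * M)) := by
                have := hN1 (e a).1
                field_simp
                norm_num
            _ ≤ _ := by gcongr
        · simp only [ha, if_false, zero_div]
          positivity
      refine (Finset.sum_le_sum fun a _ => hterm a).trans ?_
      have hsum := Equiv.sum_comp e (fun x : Fin (K + 1) × Fin d =>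
        ((if signedDigit x.1 ((v : EuclideanSpace ℝ (Fin d)) x.2) ≠ 0 then (1 : ℝ) else 0)
          + (if signedDigit x.1 ((v' : EuclideanSpace ℝ (Fin d)) x.2) ≠ 0 then 1 else 0))
            * (8 * ε ^ 2 / (N x.1 * M)))
      simp only [hs]
      rw [hsum, Fintype.sum_prod_type]
      calc _ ≤ ∑ _l : Fin (K + 1), 16 * ε ^ 2 / M := by
            refine Finset.sum_le_sum fun l _ => ?_
            simp only [← Finset.sum_mul, Finset.sum_add_distrib]
            have h1 := card_signedDigit_ne_zero_le l v
            have h2 := card_signedDigit_ne_zero_le l v'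
            have h3 := hN1 l
            calc _ ≤ (N l + N l) * (8 * ε ^ 2 / (N l * M)) := by gcongr
              _ = 16 * ε ^ 2 / M := by field_simp; norm_num
        _ = (K + 1) * (16 * ε ^ 2 / M) := by simp
        _ ≤ 4 * T * (16 * ε ^ 2 / M) := by gcongr
        _ = ε ^ 2 / (40000 * T ^ 4) := by
            rw [hM]; field_simp; norm_num
    · by_cases ha : A a
      · simp only [ha, if_true]
        have h1 : 1600 * T ^ 2 ≤ ε * (n * γ a) := by
          rw [hnγ]
          have : ε * (N (e a).1 * M / ε ^ 2) = N (e a).1 * M / ε := by field_simp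
          rw [this, le_div_iff₀ hε]
          nlinarith [hN1 (e a).1]
        linarith
      · simp only [ha, if_false, mul_zero, mul_one]
        exact hε.le
    · by_cases ha : A a
      · simp only [ha, if_true]
        refine ⟨fun b => by norm_num, ?_⟩
        rw [SignType.sum_univ]
        norm_num
      · simp only [ha, if_false]
        exact hlaw a v
    · by_cases ha : A a
      · simp only [ha, if_true]
        exact isLaw_responseLaw le_rfl zero_le_one _
      · simp only [ha, if_false]
        exact hlaw a w
    · by_cases ha : A a
      · simp only [ha, if_true]
        exact (hγ0 a).le
      · simp only [ha, if_false, le_refl]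
    · by_cases ha : A a
      · simp only [ha, if_true]
        exact hγ1 a
      · simp only [ha, if_false, zero_le_one]
    · by_cases ha : A a
      · simp only [ha, if_true, responseLaw]
        ring
      · simp only [ha, if_false]
        ring
    · by_cases ha : A a
      · simp only [ha, if_true, responseLaw_eq]
      · simp only [ha, if_false]
        ring
    · by_cases ha : A a
      · simp only [ha, if_true, responseLaw_eq]
      · simp only [ha, if_false, hquiet ha]
        ring
    · by_cases ha : A a
      · simp only [ha, if_true]
        exact neg_one_le_responseBias (hγ0 a).le (hγ1 a) _ _
      · simp only [ha, if_false]
        norm_num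
    · by_cases ha : A a
      · simp only [ha, if_true]
        exact neg_one_le_responseBias (hγ0 a).le (hγ1 a) _ _
      · simp only [ha, if_false]
        norm_num
    · by_cases ha : A a
      · simp only [ha, if_true]
        exact sum_responseBias_sq_le (hγ0 a).le (hγ1 a) _
      · simp [ha]
    · by_cases ha : A a
      · simp only [ha, if_true]
        exact sum_responseBias_sq_le (hγ0 a).le (hγ1 a) _
      · simp [ha]
    · by_cases ha : A a
      · simp only [ha, if_true]
        exact abs_responseBias_le (hγ0 a).le (hγ1 a) _ _
      · simp [ha]
    · by_cases ha : A a
      · simp only [ha, if_true]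
        exact abs_responseBias_le (hγ0 a).le (hγ1 a) _ _
      · simp [ha]
    · by_cases ha : A a
      · simp only [ha, if_true]
        have := hγ0 a
        positivity
      · simp [ha]
    · by_cases ha : A a
      · simp only [ha, if_true]
        refine Or.inr ⟨le_rfl, ?_⟩
        nlinarith [hMle a]
      · simp [ha]
  · refine ShuffleProtocol.ofRounds_err_le
      (fun a v j => if j = (e a).2 then (s a v : ℝ) / (2 ^ ((e a).1 : ℕ) * (1 - γ a)) else 0)
      fun v => ?_
    have hvar : ∀ (w : UnitSphere d) (a : Fin ((K + 1) * d)),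
        ∑ j, ∑ b, responseLaw (γ a) (s a w) b * (ψ (a, b) j -
          if j = (e a).2 then (s a w : ℝ) / (2 ^ ((e a).1 : ℕ) * (1 - γ a)) else 0) ^ 2
          ≤ 16 * M / (n * ε ^ 2) := fun w a => by
      have h2 : 0 < 1 - γ a := by linarith [hγ2 a]
      rw [Finset.sum_eq_single (e a).2]
      · have h1 : ∀ b, responseLaw (γ a) (s a w) b * (ψ (a, b) (e a).2 -
            if (e a).2 = (e a).2 then (s a w : ℝ) / (2 ^ ((e a).1 : ℕ) * (1 - γ a)) else 0) ^ 2
            = responseLaw (γ a) (s a w) b * ((b : ℝ) - (s a w : ℝ)) ^ 2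
              * (1 / (4 ^ ((e a).1 : ℕ) * (1 - γ a) ^ 2)) := fun b => by
          simp only [hψ, if_true]
          have h4 : ((2 : ℝ) ^ ((e a).1 : ℕ)) ^ 2 = 4 ^ ((e a).1 : ℕ) := by
            rw [← pow_mul, mul_comm, pow_mul]; norm_num
          rw [← sub_div, div_pow, mul_pow, h4, mul_one_div, mul_div_assoc]
        rw [Finset.sum_congr rfl fun b _ => h1 b, ← Finset.sum_mul]
        have h3 : 1 / (4 ^ ((e a).1 : ℕ) * (1 - γ a) ^ 2) ≤ 4 / (4 : ℝ) ^ ((e a).1 : ℕ) := by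
          have h4 : (1 / 2) ^ 2 ≤ (1 - γ a) ^ 2 := by
            gcongr; linarith [hγ2 a]
          rw [div_le_div_iff₀ (by positivity) (by positivity)]
          have : (0 : ℝ) < 4 ^ ((e a).1 : ℕ) := by positivity
          nlinarith
        calc _ ≤ (4 * γ a) * (4 / (4 : ℝ) ^ ((e a).1 : ℕ)) :=
              mul_le_mul (sum_responseLaw_mul_sq_le (hγ0 a).le _) h3 (by positivity)
                (by linarith [hγ0 a])
          _ = 16 * (N (e a).1 / 4 ^ ((e a).1 : ℕ)) * (M / (n * ε ^ 2)) := by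
              simp only [hγ]; ring
          -- The squared weight `4⁻ˡ` of the digit compensates for the noise level, because `N ≤ 4 ^
          -- l`.
          _ ≤ 16 * 1 * (M / (n * ε ^ 2)) := by
              gcongr
              rw [div_le_one (by positivity)]
              exact min_le_left _ _
          _ = _ := by ring
      · intro j _ hj
        simp [hψ, hj]
      · simp
    have hmean : ∀ (w : UnitSphere d) (j : Fin d),
        ∑ a, ∑ b, responseLaw (γ a) (s a w) b * ψ (a, b) j
          = ∑ l ∈ Finset.range (K + 1),
            ((signedDigit l ((w : EuclideanSpace ℝ (Fin d)) j) : SignType) : ℝ) / 2 ^ l := by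
      intro w j
      let g : Fin (K + 1) × Fin d → ℝ := fun x => if j = x.2 then
        ((signedDigit x.1 ((w : EuclideanSpace ℝ (Fin d)) x.2) : SignType) : ℝ) / 2 ^ (x.1 : ℕ)
        else 0
      have h1 : ∀ a, ∑ b, responseLaw (γ a) (s a w) b * ψ (a, b) j = g (e a) := fun a => by
        have h2 : 1 - γ a ≠ 0 := by linarith [hγ2 a]
        by_cases hj : j = (e a).2
        · simp only [g, hψ, hj, if_true, ← mul_div_assoc, ← Finset.sum_div, sum_responseLaw_mul]
          field_simp
          rfl
        · simp [g, hψ, hj]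
      refine (Finset.sum_congr rfl fun a _ => h1 a).trans ((Equiv.sum_comp e g).trans ?_)
      rw [Fintype.sum_prod_type]
      simp only [g, Finset.sum_ite_eq, Finset.mem_univ, if_true]
      exact Fin.sum_univ_eq_sum_range
        (fun l => ((signedDigit l ((w : EuclideanSpace ℝ (Fin d)) j) : SignType) : ℝ) / 2 ^ l) (K + 1)
    -- Truncation costs each user at most `2⁻ᴷ ≤ 1 / n`, so all users together at most one per
    -- coordinate.
    have hbias : ∀ j, (∑ i, (∑ a, ∑ b, responseLaw (γ a) (s a (v i)) b * ψ (a, b) j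
        - (v i : EuclideanSpace ℝ (Fin d)) j)) ^ 2 ≤ 1 := fun j => by
      rw [sq_le_one_iff_abs_le_one]
      calc _ ≤ ∑ _i : Fin n, 1 / (2 : ℝ) ^ K := by
            refine (Finset.abs_sum_le_sum_abs _ _).trans (Finset.sum_le_sum fun i _ => ?_)
            rw [hmean]
            exact abs_sum_signedDigit_sub_le ((v i).abs_le_one j) K
        _ = n / 2 ^ K := by simp; rfl
        _ ≤ 1 := by rwa [div_le_one (by positivity)]
    rw [Finset.sum_add_distrib, add_mul (16 * (4 * T) * M), one_mul]
    refine add_le_add ?_ ((Finset.sum_le_sum fun j _ => hbias j).trans ?_)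
    · rw [Finset.sum_comm]
      calc _ ≤ ∑ _i : Fin n, ∑ _a : Fin ((K + 1) * d), 16 * M / (n * ε ^ 2) := by
            refine Finset.sum_le_sum fun i _ => ?_
            rw [Finset.sum_comm]
            exact Finset.sum_le_sum fun a _ => hvar (v i) a
        _ = 16 * (K + 1) * M * (d / ε ^ 2) := by
            simp
            field_simp
        _ ≤ _ := by gcongr
    · simp
      rw [le_div_iff₀ hε20]
      nlinarith

/-! ### The trivial protocol and the choice among the three. -/

/-- The protocol without messages, whose estimate is zero. -/
theorem exists_protocol_zero (n d : ℕ) {ε δ : ℝ} (hε : 0 < ε) :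
    ∃ P : ShuffleProtocol n d 0, P.IsShuffleDP ε δ ∧ P.err ≤ ENNReal.ofReal (n ^ 2) := by
  let P : ShuffleProtocol n d 0 :=
    { Msg := Unit
      randomizer := fun _ => Measure.dirac fun _ => ()
      isProbabilityMeasure_randomizer := fun _ => inferInstance
      aggregate := fun _ => 0
      measurable_aggregate := measurable_const }
  refine ⟨P, fun D D' _ U _ => ?_, iSup_le fun v => ?_⟩
  · have h1 : P.shuffled D U = P.shuffled D' U := rfl
    rw [h1]
    refine le_add_right (le_mul_of_one_le_left' ?_)
    exact ENNReal.one_le_ofReal.2 (Real.one_le_exp hε.le)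
  · have := P.isProbabilityMeasure_shuffled v
    have h1 : ‖∑ i, (v i : EuclideanSpace ℝ (Fin d))‖ ≤ n := by
      refine (norm_sum_le _ _).trans ?_
      simp
    change ∫⁻ _, ‖(0 : EuclideanSpace ℝ (Fin d)) - ∑ i, (v i : EuclideanSpace ℝ (Fin d))‖ₑ ^ 2
      ∂P.shuffled v ≤ _
    rw [lintegral_const, measure_univ, mul_one, zero_sub, enorm_neg, ← ofReal_norm,
      ← ENNReal.ofReal_pow (norm_nonneg _)]
    gcongr

/-- The main estimate for `ε ≤ 1`. -/
theorem exists_protocol_of_le_one {n d : ℕ} {ε δ : ℝ} (hn : 1 ≤ n) (hd : 1 ≤ d) (hε : 0 < ε)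
    (hε1 : ε ≤ 1) (hδ : 0 < δ) (hδ1 : δ < 1) :
    ∃ (k : ℕ) (P : ShuffleProtocol n d k), P.IsShuffleDP ε δ ∧
      (k : ℝ) ≤ 10 ^ 9 * (1 + Real.log (n * d / δ)) ^ 6 * max 1 (min (d : ℝ) (n * ε ^ 2)) ∧
      P.err ≤ ENNReal.ofReal (10 ^ 9 * (1 + Real.log (n * d / δ)) ^ 6 * (d / ε ^ 2)) := by
  have hn1 : (1 : ℝ) ≤ n := by exact_mod_cast hn
  have hd1 : (1 : ℝ) ≤ d := by exact_mod_cast hd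
  have hnd : (1 : ℝ) ≤ n * d := one_le_mul_of_one_le_of_one_le hn1 hd1
  have hndδ : (n * d : ℝ) ≤ n * d / δ := by
    rw [le_div_iff₀ hδ]; nlinarith
  -- With this `T`, `exp T` dominates both `n * d` and `1 / δ`, as the privacy bound requires.
  obtain ⟨T, hTd⟩ : ∃ T : ℝ, T = 1 + Real.log (n * d / δ) := ⟨_, rfl⟩
  rw [← hTd]
  have hT : 1 ≤ T := by
    rw [hTd]; linarith [Real.log_nonneg (hnd.trans hndδ)]
  have hexpT : Real.exp T = Real.exp 1 * (n * d / δ) := by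
    rw [hTd, Real.exp_add, Real.exp_log (by positivity)]
  have he1 : 1 ≤ Real.exp 1 := Real.one_le_exp zero_le_one
  have hndT : (n * d : ℝ) ≤ Real.exp T := by
    rw [hexpT]; nlinarith
  have hδT : Real.exp (-T) ≤ δ := by
    rw [Real.exp_neg, hexpT, inv_le_comm₀ (by positivity) hδ]
    have : δ⁻¹ ≤ n * d / δ := by
      rw [div_eq_mul_inv]
      exact le_mul_of_one_le_left (by positivity) hnd
    nlinarith [inv_pos.2 hδ]
  have hlogn : Real.log n ≤ T := by
    have : Real.log n ≤ Real.log (n * d / δ) :=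
      Real.log_le_log (by linarith) (le_trans (by nlinarith) hndδ)
    linarith
  have hε2 : ε ^ 2 ≤ 1 := pow_le_one₀ hε.le hε1
  have hdε : (0 : ℝ) ≤ d / ε ^ 2 := by positivity
  have hTpow : ∀ m ≤ 6, T ^ m ≤ T ^ 6 := fun m hm => pow_le_pow_right₀ hT hm
  have hT6 : 1 ≤ T ^ 6 := one_le_pow₀ hT
  have hmax : (1 : ℝ) ≤ max 1 (min (d : ℝ) (n * ε ^ 2)) := le_max_left _ _
  -- For small `n * ε` the trivial error `n ^ 2` is already of order `T ^ 4 * d / ε ^ 2`.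
  rcases lt_or_ge (n * ε) (1600 * T ^ 2 * √d) with hcase | hcase
  · obtain ⟨P, hP, herr⟩ := exists_protocol_zero n d (δ := δ) hε
    refine ⟨0, P, hP, by push_cast; positivity, herr.trans (ENNReal.ofReal_le_ofReal ?_)⟩
    have h1 : (n * ε) ^ 2 ≤ (1600 * T ^ 2 * √d) ^ 2 := by gcongr
    rw [mul_pow, mul_pow, mul_pow, Real.sq_sqrt (Nat.cast_nonneg d), ← pow_mul] at h1
    rw [← mul_div_assoc, le_div_iff₀ (by positivity)]
    have := hTpow 4 (by norm_num)
    norm_num at h1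
    nlinarith
  -- Up to this threshold `n * ε ^ 2` exceeds `d` by at most a power of `T`, so `⌈n * ε ^ 2⌉₊`
  -- messages are affordable. Beyond it the digit protocol has `γ ≤ 1 / 2`.
  rcases le_or_gt (n * ε ^ 2) (2 * (2560000 * T ^ 5) * d) with hcase2 | hcase2
  · have hk1 : (⌈n * ε ^ 2⌉₊ : ℝ) < n * ε ^ 2 + 1 := Nat.ceil_lt_add_one (by positivity)
    obtain ⟨P, hP, herr⟩ := exists_protocol_of_signed_coordinates (k := ⌈n * ε ^ 2⌉₊) hd hT hε hε1
      hδT (by nlinarith) (Nat.le_ceil _) hcase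
    refine ⟨_, P, hP, ?_, herr.trans (ENNReal.ofReal_le_ofReal ?_)⟩
    · have h5 := hTpow 5 (by norm_num)
      have h51 : 1 ≤ T ^ 5 := one_le_pow₀ hT
      have h1 : n * ε ^ 2 ≤ 2 * (2560000 * T ^ 6) * max 1 (min (d : ℝ) (n * ε ^ 2)) := by
        rcases le_total (d : ℝ) (n * ε ^ 2) with h | h
        · rw [min_eq_left h, max_eq_right hd1]
          refine hcase2.trans ?_
          gcongr
        · rw [min_eq_right h]
          have h2 : n * ε ^ 2 ≤ max 1 (n * ε ^ 2) := le_max_right _ _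
          have h3 : 0 ≤ max 1 (n * ε ^ 2) := le_trans (by positivity) h2
          nlinarith
      nlinarith
    · have := hTpow 4 (by norm_num)
      gcongr
      norm_num
  · have hlog2 : (Nat.log 2 n : ℝ) ≤ 2 * T := by
      have h1 : ((2 : ℝ) ^ Nat.log 2 n) ≤ n := by exact_mod_cast Nat.pow_log_le_self 2 (by omega)
      have h2 := Real.log_le_log (by positivity) h1
      rw [Real.log_pow] at h2
      have h3 := Real.log_two_gt_d9
      nlinarith [(Nat.cast_nonneg (Nat.log 2 n) : (0 : ℝ) ≤ _)]
    have hlogn' : Nat.log 2 n + 1 ≤ n := Nat.log_lt_self 2 (by omega)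
    have hk : (((Nat.log 2 n + 1 + 1) * d : ℕ) : ℝ) ≤ 2 * Real.exp T := by
      have h1 : (Nat.log 2 n + 1 + 1) * d ≤ 2 * (n * d) := by
        calc _ ≤ (2 * n) * d := Nat.mul_le_mul_right d (by omega)
          _ = _ := by ring
      have h2 : (((Nat.log 2 n + 1 + 1) * d : ℕ) : ℝ) ≤ ((2 * (n * d) : ℕ) : ℝ) := by
        exact_mod_cast h1
      push_cast at h2 ⊢
      linarith
    -- The extra digit ensures `n ≤ 2 ^ K`, since `2 ^ Nat.log 2 n` may be smaller than `n`.
    obtain ⟨P, hP, herr⟩ := exists_protocol_of_digits (K := Nat.log 2 n + 1) hn hd hT hε hε1 hδT hk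
      (by push_cast; linarith)
      (by exact_mod_cast (Nat.lt_pow_succ_log_self (by norm_num) n).le) hcase2.le
    refine ⟨_, P, hP, ?_, herr.trans (ENNReal.ofReal_le_ofReal ?_)⟩
    · have h5 : 1 ≤ T ^ 5 := one_le_pow₀ hT
      have hdn : (d : ℝ) ≤ n * ε ^ 2 := by nlinarith
      rw [min_eq_left hdn, max_eq_right hd1]
      have h1 := hTpow 1 (by norm_num)
      rw [pow_one] at h1
      have : (((Nat.log 2 n + 1 + 1) * d : ℕ) : ℝ) ≤ (4 * T) * d := by
        push_cast
        gcongr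
        linarith
      refine this.trans ?_
      gcongr
      linarith
    · gcongr
      have e : 16 * (4 * T) * (2560000 * T ^ 5) = 163840000 * T ^ 6 := by ring
      rw [e]
      linarith

theorem ShuffleProtocol.IsShuffleDP.mono {n d k : ℕ} {P : ShuffleProtocol n d k} {ε ε' δ : ℝ}
    (h : P.IsShuffleDP ε δ) (hε : ε ≤ ε') : P.IsShuffleDP ε' δ := fun D D' hD U hU =>
  (h D D' hD U hU).trans (by gcongr)

theorem mainTheorem1 :
    ∃ c : ℕ, ∀ ε₀ : ℝ, 0 < ε₀ → ∃ C : ℝ, 0 < C ∧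
      ∀ (n d : ℕ) (ε δ : ℝ), 1 ≤ n → 1 ≤ d → 0 < ε → ε ≤ ε₀ → 0 < δ → δ < 1 →
        ∃ (k : ℕ) (P : ShuffleProtocol n d k),
          P.IsShuffleDP ε δ ∧
          (k : ℝ) ≤ C * (1 + Real.log (n * d / δ)) ^ c * max 1 (min (d : ℝ) (n * ε ^ 2)) ∧
          P.err ≤ ENNReal.ofReal (C * (1 + Real.log (n * d / δ)) ^ c * (d / ε ^ 2)) := by
  refine ⟨6, fun ε₀ hε₀ => ⟨10 ^ 9 * max 1 (ε₀ ^ 2), by positivity,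
    fun n d ε δ hn hd hε hεε₀ hδ hδ1 => ?_⟩⟩
  have hL : 0 ≤ (1 + Real.log (n * d / δ)) ^ 6 := by positivity
  -- Privacy with `min ε 1` implies privacy with `ε`. The error grows by at most the factor `max 1
  -- (ε₀ ^ 2)`, which the constant absorbs.
  obtain ⟨k, P, hP, hk, herr⟩ := exists_protocol_of_le_one (ε := min ε 1) hn hd
    (lt_min hε one_pos) (min_le_right _ _) hδ hδ1
  have hC : 1 ≤ max 1 (ε₀ ^ 2) := le_max_left _ _
  refine ⟨k, P, hP.mono (min_le_left _ _), hk.trans ?_,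
    herr.trans (ENNReal.ofReal_le_ofReal ?_)⟩
  · have hm : 0 < min ε 1 := lt_min hε one_pos
    gcongr
    · exact le_mul_of_one_le_right (by norm_num) hC
    · exact min_le_left _ _
  · have h1 : (d : ℝ) / min ε 1 ^ 2 ≤ max 1 (ε₀ ^ 2) * (d / ε ^ 2) := by
      rcases le_total ε 1 with h | h
      · rw [min_eq_left h]
        exact le_mul_of_one_le_left (by positivity) hC
      · rw [min_eq_right h, one_pow, div_one, ← mul_div_assoc, le_div_iff₀ (by positivity),
          mul_comm]
        gcongr
        exact (pow_le_pow_left₀ hε.le hεε₀ 2).trans (le_max_right _ _)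
    calc _ ≤ 10 ^ 9 * (1 + Real.log (n * d / δ)) ^ 6 * (max 1 (ε₀ ^ 2) * (d / ε ^ 2)) := by gcongr
      _ = _ := by ring
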